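/- Work in the language of second-order arithmetic, with number variables and set variables. Let $\mathsf{RCA}_0$ be the theory consisting of the basic axioms for $0,1,+,\cdot,<$, the induction scheme for $\Sigma^0_1$ formulas and the comprehension scheme for $\Delta^0_1$ formulas (both with parameters), and let $\mathsf{ACA}_0$ be the theory consisting of the basic axioms, the induction axiom $\forall X\,[(0\in X\wedge\forall n\,(n\in X\to n+1\in X))\to\forall n\,(n\in X)]$ and the comprehension scheme for all arithmetical formulas (with parameters). Functions are coded as sets of coded pairs. Let $\mathsf{HT}^{\leq 2}_4$ be the statement: for every colouring $f:\{1,2,3,\dots\}\to\{0,1,2,3\}$ there is an infinite set $H$ of positive integers such that all elements of $H$ and all sums $x+y$ of two distinct elements $x,y\in H$ have the same colour under $f$. Let $\mathsf{RT}^3_2$ be Ramsey's theorem for $2$-colourings of triples: for every $f:[\{1,2,3,\dots\}]^3\to\{0,1\}$ there is an infinite set $H$ of positive integers such that $f$ is constant on $[H]^3$. Then, over $\mathsf{RCA}_0$, $\mathsf{HT}^{\leq 2}_4$ implies $\mathsf{ACA}_0$, and hence $\mathsf{RT}^3_2$. That is, every model of $\mathsf{RCA}_0$ (in the usual Henkin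 semantics of second-order arithmetic, with arbitrary first-order part and an arbitrary collection of subsets of it as range of the set variables) in which $\mathsf{HT}^{\leq 2}_4$ holds is a model of $\mathsf{ACA}_0$ and satisfies $\mathsf{RT}^3_2$. -/

import Mathlib

/-! Second-order arithmetic: structures, arithmetical formulas, the systems `RCA₀` and `ACA₀`,
and the combinatorial principles `HT^{≤2}_k` and `RT^3_k`, all interpreted in arbitrary
(possibly nonstandard, possibly non-`ω`) structures for the language of second-order arithmetic. -/

universe u

namespace SOA

/-- A structure for the language `L₂` of second-order arithmetic with signature
`0, 1, +, ·, <, ∈`: a first-order part `Num` (the "numbers") and a nonempty collection `sets` of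
subsets of `Num` over which the set variables range. -/
structure L2Structure where
  /-- The range of the number variables. -/
  Num : Type u
  zero : Num
  one : Num
  add : Num → Num → Num
  mul : Num → Num → Num
  lt : Num → Num → Prop
  /-- The range of the set variables. -/
  sets : Set (Set Num)
  sets_nonempty : sets.Nonempty

namespace L2Structure

instance (M : L2Structure.{u}) : Zero M.Num := ⟨M.zero⟩

instance (M : L2Structure.{u}) : One M.Num := ⟨M.one⟩

instance (M : L2Structure.{u}) : Add M.Num := ⟨M.add⟩

instance (M : L2Structure.{u}) : Mul M.Num := ⟨M.mul⟩

instance (M : L2Structure.{u}) : LT M.Num := ⟨M.lt⟩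

end L2Structure

/-! ### Arithmetical formulas -/

/-- Numerical terms of `L₂`; number variables are de Bruijn indices. -/
inductive Term where
  | var (i : ℕ)
  | zero
  | one
  | add (s t : Term)
  | mul (s t : Term)

/-- Arithmetical formulas of `L₂`: formulas without set quantifiers. Free set variables, indexed
by `ℕ`, are allowed. A number quantifier binds the variable with index `0` and shifts the indices
of the other number variables by one. `ballLt t φ` and `bexLt t φ` are the bounded quantifications
`∀ x < t, φ` and `∃ x < t, φ`; the term `t` lies outside the scope of the quantifier, so that the
bound variable does not occur in it. -/
inductive Formula where
  | eq (s t : Term)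
  | lt (s t : Term)
  | mem (t : Term) (X : ℕ)
  | neg (φ : Formula)
  | and (φ ψ : Formula)
  | or (φ ψ : Formula)
  | imp (φ ψ : Formula)
  | iff (φ ψ : Formula)
  | ballLt (t : Term) (φ : Formula)
  | bexLt (t : Term) (φ : Formula)
  | all (φ : Formula)
  | ex (φ : Formula)

/-- Bounded quantifier (`Σ⁰₀`) formulas: every quantifier is a bounded number quantifier. -/
def Formula.IsBounded : Formula → Prop
  | .eq _ _ => True
  | .lt _ _ => True
  | .mem _ _ => True
  | .neg φ => φ.IsBounded
  | .and φ ψ => φ.IsBounded ∧ ψ.IsBounded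
  | .or φ ψ => φ.IsBounded ∧ ψ.IsBounded
  | .imp φ ψ => φ.IsBounded ∧ ψ.IsBounded
  | .iff φ ψ => φ.IsBounded ∧ ψ.IsBounded
  | .ballLt _ φ => φ.IsBounded
  | .bexLt _ φ => φ.IsBounded
  | .all _ => False
  | .ex _ => False

/-- `Σ⁰₁` formulas: `∃ m, θ` with `θ` a bounded quantifier formula. -/
def Formula.IsSigma1 (φ : Formula) : Prop := ∃ θ : Formula, θ.IsBounded ∧ φ = .ex θ

/-- `Π⁰₁` formulas: `∀ m, θ` with `θ` a bounded quantifier formula. -/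
def Formula.IsPi1 (φ : Formula) : Prop := ∃ θ : Formula, θ.IsBounded ∧ φ = .all θ

/-- The assignment giving the value `a` to variable `0` and the value `v i` to variable `i + 1`. -/
def push {α : Type u} (a : α) (v : ℕ → α) : ℕ → α
  | 0 => a
  | i + 1 => v i

/-- The value of a term under an assignment of the number variables. -/
def Term.val (M : L2Structure.{u}) (v : ℕ → M.Num) : Term → M.Num
  | .var i => v i
  | .zero => 0
  | .one => 1
  | .add s t => s.val M v + t.val M v
  | .mul s t => s.val M v * t.val M v

/-- Tarskian satisfaction of an arithmetical formula in `M` under an assignment `V` of the set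
variables and an assignment `v` of the number variables. -/
def Formula.Sat (M : L2Structure.{u}) (V : ℕ → M.sets) : Formula → (ℕ → M.Num) → Prop
  | .eq s t, v => s.val M v = t.val M v
  | .lt s t, v => s.val M v < t.val M v
  | .mem t X, v => t.val M v ∈ (V X : Set M.Num)
  | .neg φ, v => ¬ φ.Sat M V v
  | .and φ ψ, v => φ.Sat M V v ∧ ψ.Sat M V v
  | .or φ ψ, v => φ.Sat M V v ∨ ψ.Sat M V v
  | .imp φ ψ, v => φ.Sat M V v → ψ.Sat M V v
  | .iff φ ψ, v => (φ.Sat M V v ↔ ψ.Sat M V v)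
  | .ballLt t φ, v => ∀ a : M.Num, a < t.val M v → φ.Sat M V (push a v)
  | .bexLt t φ, v => ∃ a : M.Num, a < t.val M v ∧ φ.Sat M V (push a v)
  | .all φ, v => ∀ a : M.Num, φ.Sat M V (push a v)
  | .ex φ, v => ∃ a : M.Num, φ.Sat M V (push a v)

namespace L2Structure

/-! ### The axiom systems -/

/-- The basic axioms of second-order arithmetic. -/
structure BasicAxioms (M : L2Structure.{u}) : Prop where
  succ_ne_zero : ∀ n : M.Num, n + 1 ≠ 0
  succ_inj : ∀ m n : M.Num, m + 1 = n + 1 → m = n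
  add_zero : ∀ m : M.Num, m + 0 = m
  add_succ : ∀ m n : M.Num, m + (n + 1) = (m + n) + 1
  mul_zero : ∀ m : M.Num, m * 0 = 0
  mul_succ : ∀ m n : M.Num, m * (n + 1) = m * n + m
  not_lt_zero : ∀ m : M.Num, ¬ m < 0
  lt_succ : ∀ m n : M.Num, m < n + 1 ↔ (m < n ∨ m = n)

/-- The `Σ⁰₁` induction scheme, with number and set parameters. -/
def Sigma1Induction (M : L2Structure.{u}) : Prop :=
  ∀ φ : Formula, φ.IsSigma1 → ∀ (V : ℕ → M.sets) (v : ℕ → M.Num),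
    φ.Sat M V (push 0 v) →
    (∀ n : M.Num, φ.Sat M V (push n v) → φ.Sat M V (push (n + 1) v)) →
    ∀ n : M.Num, φ.Sat M V (push n v)

/-- The `Δ⁰₁` (recursive) comprehension scheme, with number and set parameters. -/
def Delta1Comprehension (M : L2Structure.{u}) : Prop :=
  ∀ φ ψ : Formula, φ.IsSigma1 → ψ.IsPi1 → ∀ (V : ℕ → M.sets) (v : ℕ → M.Num),
    (∀ n : M.Num, φ.Sat M V (push n v) ↔ ψ.Sat M V (push n v)) →
    ∃ X ∈ M.sets, ∀ n : M.Num, n ∈ X ↔ φ.Sat M V (push n v)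

/-- The (set) induction axiom. -/
def InductionAxiom (M : L2Structure.{u}) : Prop :=
  ∀ X ∈ M.sets, (0 : M.Num) ∈ X → (∀ n : M.Num, n ∈ X → n + 1 ∈ X) → ∀ n : M.Num, n ∈ X

/-- The arithmetical comprehension scheme, with number and set parameters. -/
def ArithmeticalComprehension (M : L2Structure.{u}) : Prop :=
  ∀ φ : Formula, ∀ (V : ℕ → M.sets) (v : ℕ → M.Num),
    ∃ X ∈ M.sets, ∀ n : M.Num, n ∈ X ↔ φ.Sat M V (push n v)

/-- `M` is a model of `RCA₀`. -/
structure ModelsRCA0 (M : L2Structure.{u}) : Prop where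
  basic : M.BasicAxioms
  induction : M.Sigma1Induction
  comprehension : M.Delta1Comprehension

/-- `M` is a model of `ACA₀`. -/
structure ModelsACA0 (M : L2Structure.{u}) : Prop where
  basic : M.BasicAxioms
  induction : M.InductionAxiom
  comprehension : M.ArithmeticalComprehension

/-! ### Combinatorial principles inside `M` -/

/-- The numeral of `k` in `M`. -/
def numeral (M : L2Structure.{u}) : ℕ → M.Num
  | 0 => 0
  | k + 1 => numeral M k + 1

/-- The code `(x + y)² + x` of the ordered pair `(x, y)`. -/
def pair (M : L2Structure.{u}) (x y : M.Num) : M.Num := (x + y) * (x + y) + x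

/-- The code of the ordered triple `(x, y, z)`. -/
def triple (M : L2Structure.{u}) (x y z : M.Num) : M.Num := M.pair (M.pair x y) z

/-- `F` is (the graph, as a set of coded pairs, of) a function from `D` to `{0, …, k - 1}`. -/
def IsColoring (M : L2Structure.{u}) (F D : Set M.Num) (k : ℕ) : Prop :=
  (∀ p ∈ F, ∃ x c : M.Num, x ∈ D ∧ c < M.numeral k ∧ p = M.pair x c) ∧
  ∀ x ∈ D, ∃! c : M.Num, M.pair x c ∈ F

/-- The positive numbers of `M`. -/
def positive (M : L2Structure.{u}) : Set M.Num := {x | 0 < x}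

/-- The codes of increasing triples of positive numbers of `M`. -/
def increasingTriples (M : L2Structure.{u}) : Set M.Num :=
  {p | ∃ x y z : M.Num, 0 < x ∧ x < y ∧ y < z ∧ p = M.triple x y z}

/-- `H` is infinite in the sense of `M`, that is, unbounded. -/
def IsInfinite (M : L2Structure.{u}) (H : Set M.Num) : Prop :=
  ∀ n : M.Num, ∃ m ∈ H, n < m

/-- `FS^{≤2}(H)`: the set of non-empty sums of at most two distinct elements of `H`. -/
def sumsLe2 (M : L2Structure.{u}) (H : Set M.Num) : Set M.Num :=
  {s | s ∈ H ∨ ∃ x ∈ H, ∃ y ∈ H, x ≠ y ∧ s = x + y}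

/-- `M` satisfies `HT^{≤2}_k`: for every colouring `F` of the positive numbers with `k` colours
there is an infinite set `H` of positive numbers such that `FS^{≤2}(H)` is monochromatic. -/
def HTle2 (M : L2Structure.{u}) (k : ℕ) : Prop :=
  ∀ F ∈ M.sets, M.IsColoring F M.positive k →
    ∃ H ∈ M.sets, H ⊆ M.positive ∧ M.IsInfinite H ∧
      ∃ c : M.Num, ∀ s ∈ M.sumsLe2 H, M.pair s c ∈ F

/-- `M` satisfies `RT^3_k`: for every colouring `F` of the increasing triples of positive numbers
with `k` colours there is an infinite set `H` of positive numbers all of whose increasing triples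
have the same colour. -/
def RT3 (M : L2Structure.{u}) (k : ℕ) : Prop :=
  ∀ F ∈ M.sets, M.IsColoring F M.increasingTriples k →
    ∃ H ∈ M.sets, H ⊆ M.positive ∧ M.IsInfinite H ∧
      ∃ c : M.Num, ∀ x ∈ H, ∀ y ∈ H, ∀ z ∈ H, x < y → y < z →
        M.pair (M.triple x y z) c ∈ F

end L2Structure

end SOA

-- The crux is that `HT^{≤2}_4` yields `Σ⁰₁` comprehension. Let `R` enumerate a set, `x` entering
-- before stage `s` if `R x y` holds for some `y < s`. Write `n` in base three, with lowest nonzero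
-- digit (1 or 2) at place `l`. A higher place `p` with nonzero digit is important if some `x < l`
-- enters between stage `n % p`, the part of `n` below `p`, and stage `p`. The colour of `n` records
-- its lowest nonzero digit and the parity of the number of important places.
--
-- Let `H` be infinite with all sums of at most two elements of one colour. Two elements with the
-- same lowest place and digit `d` would have a sum with lowest digit `2d mod 3 ≠ d`, so the lowest
-- places are unbounded on `H` (`exists_low_gt`). Now let `n ∈ H` have lowest place `l`, and suppose
-- that some `x < l` enters, but not before stage `n`. Choose `m ∈ H` whose lowest place `q` exceeds
-- `n` and is so large that every `x < l` that ever enters does so before stage `q`. Then `n + m`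
-- has exactly the important places of `n` and, in addition, `q` (`Code.add`). The parity flips, a
-- contradiction. Hence each `x < l` that ever enters does so before stage `n` (`enum_of_mem`), and
-- the enumerated set is `Δ⁰₁` in `H`.
--
-- Exponentiation and sequence coding are avoided. Powers of three are described by their divisors;
-- the important places are collected in one number with ternary digits 0 and 1, whose parity counts
-- them because powers of three are odd; finite sets are coded by divisibility by coprime moduli,
-- which also gives strong `Σ⁰₁` bounding (`strong_bounding`).
--
-- `Σ⁰₁` comprehension then absorbs unbounded quantifiers one at a time into set parameters
-- (`Formula.dfn_sat`), which gives arithmetical comprehension. For triples, `exists_cohesive` is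
-- applied twice: the colour loses its dependence on the third element, then on the second, and the
-- pigeonhole principle handles the first.
--
-- Definability conditions are left to instance search through the classes `Dfn`, `Tm` and `BFun`.

namespace SOA

/-! ### Renaming of variables and definable predicates -/

/-- Rename the number variables of a term. -/
def Term.rename (ρ : ℕ → ℕ) : Term → Term
  | .var i => .var (ρ i)
  | .zero => .zero
  | .one => .one
  | .add s t => .add (s.rename ρ) (t.rename ρ)
  | .mul s t => .mul (s.rename ρ) (t.rename ρ)

/-- The renaming `ρ` under a binder. -/
def liftRen (ρ : ℕ → ℕ) : ℕ → ℕ := push 0 fun i => ρ i + 1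

/-- Rename the set variables by `σ` and the number variables by `ρ`. -/
def Formula.rename (σ : ℕ → ℕ) : Formula → (ℕ → ℕ) → Formula
  | .eq s t, ρ => .eq (s.rename ρ) (t.rename ρ)
  | .lt s t, ρ => .lt (s.rename ρ) (t.rename ρ)
  | .mem t X, ρ => .mem (t.rename ρ) (σ X)
  | .neg φ, ρ => .neg (φ.rename σ ρ)
  | .and φ ψ, ρ => .and (φ.rename σ ρ) (ψ.rename σ ρ)
  | .or φ ψ, ρ => .or (φ.rename σ ρ) (ψ.rename σ ρ)
  | .imp φ ψ, ρ => .imp (φ.rename σ ρ) (ψ.rename σ ρ)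
  | .iff φ ψ, ρ => .iff (φ.rename σ ρ) (ψ.rename σ ρ)
  | .ballLt t φ, ρ => .ballLt (t.rename ρ) (φ.rename σ (liftRen ρ))
  | .bexLt t φ, ρ => .bexLt (t.rename ρ) (φ.rename σ (liftRen ρ))
  | .all φ, ρ => .all (φ.rename σ (liftRen ρ))
  | .ex φ, ρ => .ex (φ.rename σ (liftRen ρ))

theorem Formula.IsBounded.rename {φ : Formula} (h : φ.IsBounded) (σ ρ : ℕ → ℕ) :
    (φ.rename σ ρ).IsBounded := by
  induction φ generalizing ρ <;> simp_all [Formula.rename, Formula.IsBounded]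

variable {M : L2Structure.{u}}

theorem Term.val_rename (v : ℕ → M.Num) (ρ : ℕ → ℕ) (t : Term) :
    (t.rename ρ).val M v = t.val M (v ∘ ρ) := by
  induction t <;> simp_all [Term.rename, Term.val]

theorem push_comp_liftRen {α : Type u} (a : α) (v : ℕ → α) (ρ : ℕ → ℕ) :
    push a v ∘ liftRen ρ = push a (v ∘ ρ) := by
  funext i; cases i <;> rfl

theorem Formula.sat_rename (V : ℕ → M.sets) (σ ρ : ℕ → ℕ) (φ : Formula) (v : ℕ → M.Num) :
    (φ.rename σ ρ).Sat M V v ↔ φ.Sat M (V ∘ σ) (v ∘ ρ) := by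
  induction φ generalizing v ρ <;>
    simp_all [Formula.rename, Formula.Sat, Term.val_rename, push_comp_liftRen]

/-- Interleave two sequences: `u` at the even places and `w` at the odd places. -/
def inter {α : Type u} (u w : ℕ → α) : ℕ → α :=
  fun i => if i % 2 = 0 then u (i / 2) else w (i / 2)

section inter

variable {α : Type u} (u w : ℕ → α)

@[simp] theorem inter_even (i : ℕ) : inter u w (2 * i) = u i := by
  simp [inter]

@[simp] theorem inter_odd (i : ℕ) : inter u w (2 * i + 1) = w i := by
  have : (2 * i + 1) / 2 = i := by omega
  simp [inter, this]

theorem inter_comp_left : inter u w ∘ (fun i => 2 * i) = u := by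
  funext i; simp

theorem inter_comp_right : inter u w ∘ (fun i => 2 * i + 1) = w := by
  funext i; simp

theorem inter_comp_inter (f g : ℕ → ℕ) (x : ℕ → α) :
    x ∘ inter f g = inter (x ∘ f) (x ∘ g) := by
  funext i; by_cases h : i % 2 = 0 <;> simp [inter, h]

/-- The renaming that makes room for a bound variable in an interleaved assignment. -/
def binderRen : ℕ → ℕ := inter (push 0 fun i => 2 * i + 1) fun i => 2 * i + 2

theorem push_inter (a : α) : push a (inter u w) ∘ binderRen = inter (push a u) w := by
  rw [binderRen, inter_comp_inter]
  congr 1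
  · funext i; cases i
    · rfl
    · exact inter_even u w _
  · funext i; exact inter_odd u w _

end inter

/-- Predicates of assignments that are defined by a formula with parameters `V` and `w`; the
formula has to be a bounded quantifier formula if `b` holds. -/
def DfnAt (b : Prop) (V : ℕ → M.sets) (w : ℕ → M.Num) (P : (ℕ → M.Num) → Prop) : Prop :=
  ∃ φ : Formula, (b → φ.IsBounded) ∧ ∀ v, φ.Sat M V (inter v w) ↔ P v

/-- Functions of assignments that are defined by a term with parameters `w`. -/
def TmAt (w : ℕ → M.Num) (f : (ℕ → M.Num) → M.Num) : Prop :=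
  ∃ t : Term, ∀ v, t.val M (inter v w) = f v

/-- Predicates defined by a formula with parameters, by a bounded one if `b` holds. -/
class Dfn (b : Prop) (P : (ℕ → M.Num) → Prop) : Prop where
  out : ∃ V w, DfnAt b V w P

/-- Functions defined by a term with parameters. -/
class Tm (f : (ℕ → M.Num) → M.Num) : Prop where
  out : ∃ w, TmAt w f

theorem TmAt.comp {w : ℕ → M.Num} {f : (ℕ → M.Num) → M.Num} (h : TmAt w f)
    {w' : ℕ → M.Num} (ρ σ : ℕ → ℕ) (hw : w' ∘ ρ = w) : TmAt w' fun v => f (v ∘ σ) := by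
  obtain ⟨t, ht⟩ := h
  refine ⟨t.rename (inter (fun i => 2 * σ i) fun i => 2 * ρ i + 1), fun v => ?_⟩
  rw [Term.val_rename, inter_comp_inter]
  refine Eq.trans ?_ (ht (v ∘ σ))
  rw [← hw]
  congr 2 <;> funext i <;> simp

theorem DfnAt.comp {b : Prop} {V : ℕ → M.sets} {w : ℕ → M.Num} {P : (ℕ → M.Num) → Prop}
    (h : DfnAt b V w P) {V' : ℕ → M.sets} {w' : ℕ → M.Num} (τ ρ σ : ℕ → ℕ) (hV : V' ∘ τ = V)
    (hw : w' ∘ ρ = w) : DfnAt b V' w' fun v => P (v ∘ σ) := by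
  obtain ⟨φ, hb, h⟩ := h
  refine ⟨φ.rename τ (inter (fun i => 2 * σ i) fun i => 2 * ρ i + 1),
    fun hh => (hb hh).rename _ _, fun v => ?_⟩
  refine Iff.trans ?_ (h (v ∘ σ))
  rw [Formula.sat_rename, inter_comp_inter, ← hw, hV]
  have e1 : (inter v w' ∘ fun i => 2 * σ i) = v ∘ σ := by funext i; simp
  have e2 : (inter v w' ∘ fun i => 2 * ρ i + 1) = w' ∘ ρ := by funext i; simp
  rw [e1, e2]

theorem Dfn.comp (b : Prop) {P : (ℕ → M.Num) → Prop} [h : Dfn b P] (σ : ℕ → ℕ) :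
    Dfn b fun v => P (v ∘ σ) := by
  obtain ⟨V, w, h⟩ := h
  exact ⟨V, w, h.comp id id σ rfl rfl⟩

theorem Dfn.congr {b : Prop} {P : (ℕ → M.Num) → Prop} (h : Dfn b P) {Q : (ℕ → M.Num) → Prop}
    (e : ∀ v, P v ↔ Q v) : Dfn b Q := by
  have : P = Q := funext fun v => propext (e v)
  exact this ▸ h

/-- Interleaving the two parameter lists provides common parameters; every binary connective needs
this. -/
theorem Dfn.merge {b : Prop} {P Q : (ℕ → M.Num) → Prop} (h : Dfn b P) (h' : Dfn b Q) :
    ∃ V w, DfnAt b V w P ∧ DfnAt b V w Q := by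
  obtain ⟨V, w, h⟩ := h
  obtain ⟨V', w', h'⟩ := h'
  exact ⟨inter V V', inter w w',
    h.comp _ _ id (inter_comp_left V V') (inter_comp_left w w'),
    h'.comp _ _ id (inter_comp_right V V') (inter_comp_right w w')⟩

theorem Tm.merge {f g : (ℕ → M.Num) → M.Num} (h : Tm f) (h' : Tm g) :
    ∃ w, TmAt w f ∧ TmAt w g := by
  obtain ⟨w, h⟩ := h
  obtain ⟨w', h'⟩ := h'
  exact ⟨inter w w', h.comp _ id (inter_comp_left w w'), h'.comp _ id (inter_comp_right w w')⟩

theorem Dfn.mergeTm {b : Prop} {P : (ℕ → M.Num) → Prop} {f : (ℕ → M.Num) → M.Num} (h : Dfn b P)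
    (h' : Tm f) : ∃ V w, DfnAt b V w P ∧ TmAt w f := by
  obtain ⟨V, w, h⟩ := h
  obtain ⟨w', h'⟩ := h'
  exact ⟨V, inter w w', h.comp id _ id rfl (inter_comp_left w w'),
    h'.comp _ id (inter_comp_right w w')⟩

/-! ### Closure of definability under terms, connectives and quantifiers -/

instance Tm.var (i : ℕ) : Tm (M := M) fun v => v i :=
  ⟨fun _ => 0, .var (2 * i), fun v => by simp [Term.val]⟩

instance Tm.const (c : M.Num) : Tm fun _ => c :=
  ⟨fun _ => c, .var 1, fun v => inter_odd v _ 0⟩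

instance Tm.add (f g : (ℕ → M.Num) → M.Num) [hf : Tm f] [hg : Tm g] : Tm fun v => f v + g v := by
  obtain ⟨w, ⟨s, hs⟩, t, ht⟩ := hf.merge hg
  exact ⟨w, .add s t, fun v => by rw [Term.val, hs, ht]⟩

instance Tm.mul (f g : (ℕ → M.Num) → M.Num) [hf : Tm f] [hg : Tm g] : Tm fun v => f v * g v := by
  obtain ⟨w, ⟨s, hs⟩, t, ht⟩ := hf.merge hg
  exact ⟨w, .mul s t, fun v => by rw [Term.val, hs, ht]⟩

theorem Tm.tail (f : (ℕ → M.Num) → M.Num) [h : Tm f] : Tm fun v => f fun i => v (i + 1) := by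
  obtain ⟨w, h⟩ := h
  exact ⟨w, h.comp id (fun i => i + 1) rfl⟩

section connectives

variable (b : Prop) (P Q : (ℕ → M.Num) → Prop)

instance Dfn.and [hP : Dfn b P] [hQ : Dfn b Q] : Dfn b fun v => P v ∧ Q v := by
  obtain ⟨V, w, ⟨φ, hφ, h⟩, ψ, hψ, h'⟩ := hP.merge hQ
  exact ⟨V, w, .and φ ψ, fun hb => ⟨hφ hb, hψ hb⟩, fun v => by rw [Formula.Sat, h, h']⟩

instance Dfn.or [hP : Dfn b P] [hQ : Dfn b Q] : Dfn b fun v => P v ∨ Q v := by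
  obtain ⟨V, w, ⟨φ, hφ, h⟩, ψ, hψ, h'⟩ := hP.merge hQ
  exact ⟨V, w, .or φ ψ, fun hb => ⟨hφ hb, hψ hb⟩, fun v => by rw [Formula.Sat, h, h']⟩

instance Dfn.imp [hP : Dfn b P] [hQ : Dfn b Q] : Dfn b fun v => P v → Q v := by
  obtain ⟨V, w, ⟨φ, hφ, h⟩, ψ, hψ, h'⟩ := hP.merge hQ
  exact ⟨V, w, .imp φ ψ, fun hb => ⟨hφ hb, hψ hb⟩, fun v => by rw [Formula.Sat, h, h']⟩

instance Dfn.iff [hP : Dfn b P] [hQ : Dfn b Q] : Dfn b fun v => (P v ↔ Q v) := by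
  obtain ⟨V, w, ⟨φ, hφ, h⟩, ψ, hψ, h'⟩ := hP.merge hQ
  exact ⟨V, w, .iff φ ψ, fun hb => ⟨hφ hb, hψ hb⟩, fun v => by rw [Formula.Sat, h, h']⟩

instance Dfn.not [hP : Dfn b P] : Dfn b fun v => ¬ P v := by
  obtain ⟨V, w, φ, hφ, h⟩ := hP
  exact ⟨V, w, .neg φ, fun hb => hφ hb, fun v => by rw [Formula.Sat, h]⟩

end connectives

instance Dfn.eqTm (b : Prop) (f g : (ℕ → M.Num) → M.Num) [hf : Tm f] [hg : Tm g] :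
    Dfn b fun v => f v = g v := by
  obtain ⟨w, ⟨s, hs⟩, t, ht⟩ := hf.merge hg
  exact ⟨fun _ => ⟨_, M.sets_nonempty.some_mem⟩, w, .eq s t, fun _ => trivial,
    fun v => by rw [Formula.Sat, hs, ht]⟩

instance Dfn.ltTm (b : Prop) (f g : (ℕ → M.Num) → M.Num) [hf : Tm f] [hg : Tm g] :
    Dfn b fun v => f v < g v := by
  obtain ⟨w, ⟨s, hs⟩, t, ht⟩ := hf.merge hg
  exact ⟨fun _ => ⟨_, M.sets_nonempty.some_mem⟩, w, .lt s t, fun _ => trivial,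
    fun v => by rw [Formula.Sat, hs, ht]⟩

/-- `X` is one of the sets of `M`. -/
class IsSet (X : Set M.Num) : Prop where
  out : X ∈ M.sets

instance Dfn.memTm (b : Prop) (f : (ℕ → M.Num) → M.Num) (X : Set M.Num) [hf : Tm f]
    [hX : IsSet X] : Dfn b fun v => f v ∈ X := by
  obtain ⟨w, s, hs⟩ := hf
  exact ⟨fun _ => ⟨X, hX.out⟩, w, .mem s 0, fun _ => trivial, fun v => by rw [Formula.Sat, hs]⟩

/-- The hypothesis has the de Bruijn shape of the quantifier's body, with the bound variable at
index `0`, so that instance search can descend through nested binders. -/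
instance Dfn.ball (b : Prop) (f : (ℕ → M.Num) → M.Num) (P : M.Num → (ℕ → M.Num) → Prop)
    [hf : Tm f] [hP : Dfn b fun v => P (v 0) fun i => v (i + 1)] :
    Dfn b fun v => ∀ a, a < f v → P a v := by
  obtain ⟨V, w, ⟨φ, hφ, h⟩, t, ht⟩ := hP.mergeTm hf
  refine ⟨V, w, .ballLt t (φ.rename id binderRen), fun hb => (hφ hb).rename _ _, fun v => ?_⟩
  · simp only [Formula.Sat, Formula.sat_rename, ht]
    refine forall_congr' fun a => ?_
    rw [push_inter]
    exact imp_congr Iff.rfl (h (push a v))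

instance Dfn.bex (b : Prop) (f : (ℕ → M.Num) → M.Num) (P : M.Num → (ℕ → M.Num) → Prop)
    [hf : Tm f] [hP : Dfn b fun v => P (v 0) fun i => v (i + 1)] :
    Dfn b fun v => ∃ a, a < f v ∧ P a v := by
  obtain ⟨V, w, ⟨φ, hφ, h⟩, t, ht⟩ := hP.mergeTm hf
  refine ⟨V, w, .bexLt t (φ.rename id binderRen), fun hb => (hφ hb).rename _ _, fun v => ?_⟩
  · simp only [Formula.Sat, Formula.sat_rename, ht]
    refine exists_congr fun a => ?_
    rw [push_inter]
    exact and_congr Iff.rfl (h (push a v))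

instance Dfn.all (P : M.Num → (ℕ → M.Num) → Prop)
    [hP : Dfn False fun v => P (v 0) fun i => v (i + 1)] : Dfn False fun v => ∀ a, P a v := by
  obtain ⟨V, w, φ, -, h⟩ := hP
  refine ⟨V, w, .all (φ.rename id binderRen), False.elim, fun v => ?_⟩
  · simp only [Formula.Sat, Formula.sat_rename]
    refine forall_congr' fun a => ?_
    rw [push_inter]
    exact h (push a v)

instance Dfn.ex (P : M.Num → (ℕ → M.Num) → Prop)
    [hP : Dfn False fun v => P (v 0) fun i => v (i + 1)] : Dfn False fun v => ∃ a, P a v := by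
  obtain ⟨V, w, φ, -, h⟩ := hP
  refine ⟨V, w, .ex (φ.rename id binderRen), False.elim, fun v => ?_⟩
  · simp only [Formula.Sat, Formula.sat_rename]
    refine exists_congr fun a => ?_
    rw [push_inter]
    exact h (push a v)

theorem Dfn.of_bounded {P : (ℕ → M.Num) → Prop} [h : Dfn True P] (b : Prop) : Dfn b P := by
  obtain ⟨V, w, φ, hφ, h⟩ := h
  exact ⟨V, w, φ, fun _ => hφ trivial, h⟩

/-- `M` is a model of `RCA₀`, as a class. -/
class RCA (M : L2Structure.{u}) : Prop where
  out : M.ModelsRCA0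

/-- The renaming from interleaved assignments to assignments with two leading variables. -/
def schemeRen : ℕ → ℕ := inter (push 0 fun _ => 1) fun i => i + 2

theorem push_push_inter {α : Type u} (m n : α) (w : ℕ → α) :
    push m (push n w) ∘ schemeRen = inter (push m fun _ => n) w := by
  rw [schemeRen, inter_comp_inter]
  congr 1
  funext i; cases i <;> rfl

/-- A bounded binary predicate gives a formula `θ` for the `Σ⁰₁` and `Π⁰₁` schemes. -/
theorem exists_formula (P : M.Num → M.Num → Prop) [h : Dfn True fun v => P (v 1) (v 0)] :
    ∃ (θ : Formula) (V : ℕ → M.sets) (w : ℕ → M.Num), θ.IsBounded ∧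
      ∀ m n, θ.Sat M V (push m (push n w)) ↔ P n m := by
  obtain ⟨V, w, φ, hb, h⟩ := h
  refine ⟨φ.rename id schemeRen, V, w,
    (hb trivial).rename _ _, fun m n => ?_⟩
  rw [Formula.sat_rename, push_push_inter]
  exact h (push m fun _ => n)

/-! ### The schemes of `RCA₀` for definable predicates -/

section induction

variable [hM : RCA M]

theorem sigma_induction {P : M.Num → M.Num → Prop} [Dfn True fun v => P (v 1) (v 0)]
    (h0 : ∃ m, P 0 m) (hs : ∀ n, (∃ m, P n m) → ∃ m, P (n + 1) m) (n : M.Num) : ∃ m, P n m := by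
  obtain ⟨θ, V, w, hb, h⟩ := exists_formula P
  have := hM.out.induction (.ex θ) ⟨θ, hb, rfl⟩ V w
  simp only [Formula.Sat, h] at this
  exact this h0 hs n

theorem bdd_induction {P : M.Num → Prop} [h : Dfn True fun v => P (v 0)]
    (h0 : P 0) (hs : ∀ n, P n → P (n + 1)) (n : M.Num) : P n := by
  have : Dfn True fun v : ℕ → M.Num => P (v 1) := h.comp _ fun _ => 1
  simpa using sigma_induction (P := fun n _ => P n) ⟨0, h0⟩ (fun n ⟨_, h⟩ => ⟨0, hs n h⟩) n

theorem delta_comprehension {P Q : M.Num → M.Num → Prop} [Dfn True fun v => P (v 1) (v 0)]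
    [Dfn True fun v => Q (v 1) (v 0)] (hPQ : ∀ n, (∃ m, P n m) ↔ ∀ m, Q n m) :
    IsSet {n : M.Num | ∃ m, P n m} := by
  obtain ⟨V, w, ⟨φ, hφ, h⟩, ψ, hψ, h'⟩ :=
    Dfn.merge (b := True) (P := fun v : ℕ → M.Num => P (v 1) (v 0))
      (Q := fun v : ℕ → M.Num => Q (v 1) (v 0)) inferInstance inferInstance
  have hr (χ : Formula) (m n : M.Num) :
      (χ.rename id schemeRen).Sat M V (push m (push n w)) ↔
        χ.Sat M V (inter (push m fun _ => n) w) := by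
    rw [Formula.sat_rename, push_push_inter]; rfl
  obtain ⟨X, hX, hXP⟩ := hM.out.comprehension (.ex (φ.rename id schemeRen)) (.all (ψ.rename id schemeRen))
    ⟨_, (hφ trivial).rename _ _, rfl⟩ ⟨_, (hψ trivial).rename _ _, rfl⟩ V w fun n => by
      simp only [Formula.Sat, hr, h, h']
      exact hPQ n
  refine ⟨?_⟩
  convert hX
  ext n
  simp only [hXP, Formula.Sat, hr, h]
  rfl

theorem bdd_comprehension {P : M.Num → Prop} [h : Dfn True fun v => P (v 0)] :
    IsSet {n | P n} := by
  have : Dfn True fun v : ℕ → M.Num => P (v 1) := h.comp _ fun _ => 1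
  simpa using delta_comprehension (P := fun n _ => P n) (Q := fun n _ => P n)
    fun n => by simp

end induction

variable [hM : RCA M]

/-! ### The first-order part as an ordered semiring -/

namespace Arith

theorem add_zero' (m : M.Num) : m + 0 = m := hM.out.basic.add_zero m
theorem add_succ' (m n : M.Num) : m + (n + 1) = m + n + 1 := hM.out.basic.add_succ m n
theorem mul_zero' (m : M.Num) : m * 0 = 0 := hM.out.basic.mul_zero m
theorem mul_succ' (m n : M.Num) : m * (n + 1) = m * n + m := hM.out.basic.mul_succ m n

theorem add_assoc' (a b c : M.Num) : a + b + c = a + (b + c) := by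
  refine bdd_induction (P := fun c => a + b + c = a + (b + c)) ?_ (fun n h => ?_) c
  · simp only [add_zero']
  · simp only [add_succ', h]

theorem zero_add' (a : M.Num) : 0 + a = a := by
  refine bdd_induction (P := fun a : M.Num => 0 + a = a) (add_zero' 0) (fun n h => ?_) a
  simp only [add_succ', h]

theorem succ_add' (a b : M.Num) : a + 1 + b = a + b + 1 := by
  refine bdd_induction (P := fun b : M.Num => a + 1 + b = a + b + 1) ?_ (fun n h => ?_) b
  · simp only [add_zero']
  · simp only [add_succ', h]

theorem add_comm' (a b : M.Num) : a + b = b + a := by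
  refine bdd_induction (P := fun b : M.Num => a + b = b + a) ?_ (fun n h => ?_) b
  · simp only [add_zero', zero_add']
  · simp only [add_succ', h, succ_add']

theorem left_distrib' (a b c : M.Num) : a * (b + c) = a * b + a * c := by
  refine bdd_induction (P := fun c => a * (b + c) = a * b + a * c) ?_ (fun n h => ?_) c
  · simp only [add_zero', mul_zero']
  · rw [add_succ', mul_succ', h, mul_succ', add_assoc']

theorem zero_mul' (a : M.Num) : 0 * a = 0 := by
  refine bdd_induction (P := fun a : M.Num => 0 * a = 0) (mul_zero' 0) (fun n h => ?_) a
  simp only [mul_succ', h, add_zero']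

theorem succ_mul' (a b : M.Num) : (a + 1) * b = a * b + b := by
  refine bdd_induction (P := fun b : M.Num => (a + 1) * b = a * b + b) ?_ (fun n h => ?_) b
  · simp only [mul_zero', add_zero']
  · rw [mul_succ', h, mul_succ', ← add_assoc', ← add_assoc', add_assoc' _ n, add_comm' n,
      ← add_assoc']

theorem mul_comm' (a b : M.Num) : a * b = b * a := by
  refine bdd_induction (P := fun b : M.Num => a * b = b * a) ?_ (fun n h => ?_) b
  · simp only [mul_zero', zero_mul']
  · simp only [mul_succ', h, succ_mul']

theorem mul_assoc' (a b c : M.Num) : a * b * c = a * (b * c) := by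
  refine bdd_induction (P := fun c => a * b * c = a * (b * c)) ?_ (fun n h => ?_) c
  · simp only [mul_zero']
  · rw [mul_succ', h, mul_succ', left_distrib']

theorem one_mul' (a : M.Num) : 1 * a = a := by
  refine bdd_induction (P := fun a : M.Num => 1 * a = a) (mul_zero' 1) (fun n h => ?_) a
  simp only [mul_succ', h]

end Arith

open Arith in
instance : CommSemiring M.Num where
  add_assoc := add_assoc'
  zero_add := zero_add'
  add_zero := add_zero'
  add_comm := add_comm'
  nsmul := nsmulRec
  left_distrib := left_distrib'
  right_distrib a b c := by rw [Arith.mul_comm', left_distrib', Arith.mul_comm' c, Arith.mul_comm' c]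
  zero_mul := zero_mul'
  mul_zero := mul_zero'
  mul_assoc := mul_assoc'
  one_mul := one_mul'
  mul_one a := by rw [Arith.mul_comm', one_mul']
  mul_comm := Arith.mul_comm'

namespace Arith

theorem lt_succ' (m n : M.Num) : m < n + 1 ↔ m < n ∨ m = n := hM.out.basic.lt_succ m n

theorem lt_add_succ' (m n : M.Num) : m < m + (n + 1) := by
  refine bdd_induction (P := fun n => m < m + (n + 1)) ?_ (fun n h => ?_) n
  · rw [zero_add, lt_succ']; exact .inr rfl
  · rw [← add_assoc, lt_succ']; exact .inl h

theorem exists_of_lt' {m n : M.Num} (h : m < n) : ∃ d, n = m + (d + 1) := by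
  have := sigma_induction (P := fun n d : M.Num => m < n → n = m + (d + 1))
    ⟨0, fun h => (hM.out.basic.not_lt_zero m h).elim⟩ (fun n ⟨d, h⟩ => ?_) n
  · exact this.imp fun _ h' => h' h
  · rcases Classical.em (m < n) with h' | h'
    · exact ⟨d + 1, fun _ => by rw [h h']; simp only [add_assoc]⟩
    · refine ⟨0, fun h'' => ?_⟩
      rw [lt_succ'] at h''
      rw [h''.resolve_left h', zero_add]

theorem succ_ne (a b : M.Num) : a + b + 1 ≠ a := by
  refine bdd_induction (P := fun a => a + b + 1 ≠ a) ?_ (fun n h h' => h ?_) a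
  · exact hM.out.basic.succ_ne_zero _
  · refine hM.out.basic.succ_inj _ _ (Eq.trans ?_ h')
    simp only [add_assoc, add_comm, add_left_comm]

theorem lt_iff' {m n : M.Num} : m < n ↔ ∃ d, n = m + (d + 1) :=
  ⟨exists_of_lt', fun ⟨d, h⟩ => h ▸ lt_add_succ' m d⟩

theorem lt_irrefl' (m : M.Num) : ¬ m < m := fun h => by
  obtain ⟨d, h⟩ := exists_of_lt' h
  exact succ_ne m d (by rw [add_assoc, ← h])

theorem lt_trans' {a b c : M.Num} (h : a < b) (h' : b < c) : a < c := by
  obtain ⟨d, rfl⟩ := exists_of_lt' h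
  obtain ⟨e, rfl⟩ := exists_of_lt' h'
  exact lt_iff'.2 ⟨d + 1 + e, by simp only [add_assoc]⟩

theorem trichotomy' (a b : M.Num) : a < b ∨ a = b ∨ b < a := by
  have h0 (b : M.Num) : 0 < b ∨ 0 = b := by
    refine bdd_induction (P := fun b : M.Num => 0 < b ∨ 0 = b) (.inr rfl) (fun n h => ?_) b
    exact .inl ((lt_succ' 0 n).2 (h.imp id id))
  refine bdd_induction (P := fun a => a < b ∨ a = b ∨ b < a) ?_ (fun n h => ?_) a
  · exact (h0 b).imp id .inl
  · rcases h with h | rfl | h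
    · obtain ⟨d, rfl⟩ := exists_of_lt' h
      rcases h0 d with h | rfl
      · obtain ⟨e, rfl⟩ := exists_of_lt' h
        exact .inl (lt_iff'.2 ⟨e, by simp only [zero_add, add_comm, add_left_comm]⟩)
      · exact .inr (.inl (by rw [zero_add]))
    · exact .inr (.inr ((lt_succ' _ _).2 (.inr rfl)))
    · exact .inr (.inr ((lt_succ' _ _).2 (.inl h)))

end Arith

open Arith Classical in
noncomputable instance : LinearOrder M.Num where
  -- With this choice `Dfn.le` holds by unfolding.
  le a b := a < b ∨ a = b
  lt := (· < ·)
  le_refl _ := .inr rfl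
  le_trans := by
    rintro a b c (h | rfl) (h' | rfl)
    · exact .inl (lt_trans' h h')
    · exact .inl h
    · exact .inl h'
    · exact .inr rfl
  lt_iff_le_not_ge a b :=
    ⟨fun h => ⟨.inl h, fun h' => h'.elim (fun h' => lt_irrefl' _ (lt_trans' h h'))
      fun e => lt_irrefl' b (e ▸ h)⟩, fun ⟨h, h'⟩ => h.resolve_right fun e => h' (.inr e.symm)⟩
  le_antisymm := by
    rintro a b (h | h) (h' | h')
    · exact (lt_irrefl' _ (lt_trans' h h')).elim
    exacts [h'.symm, h, h]
  le_total a b := by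
    rcases trichotomy' a b with h | h | h
    exacts [.inl (.inl h), .inl (.inr h), .inr (.inl h)]
  toDecidableLE := Classical.decRel _

namespace Arith

theorem lt_add_one_iff {a b : M.Num} : a < b + 1 ↔ a ≤ b := lt_succ' a b

theorem exists_of_le {a b : M.Num} (h : a ≤ b) : ∃ d, b = a + d := by
  rcases h with h | rfl
  · exact (exists_of_lt' h).imp' (· + 1) fun _ => id
  · exact ⟨0, (add_zero a).symm⟩

theorem le_add_right' (a b : M.Num) : a ≤ a + b := by
  rcases trichotomy' 0 b with h | rfl | h
  · obtain ⟨d, rfl⟩ := exists_of_lt' h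
    rw [zero_add]; exact .inl (lt_add_succ' _ _)
  · exact .inr (add_zero a).symm
  · exact (hM.out.basic.not_lt_zero _ h).elim

theorem add_left_cancel' {a b c : M.Num} (h : a + b = a + c) : b = c := by
  rcases trichotomy' b c with h' | h' | h'
  · obtain ⟨d, rfl⟩ := exists_of_lt' h'
    refine (lt_irrefl' (a + b) ?_).elim
    nth_rw 2 [h]; rw [← add_assoc]; exact lt_add_succ' _ _
  · exact h'
  · obtain ⟨d, rfl⟩ := exists_of_lt' h'
    refine (lt_irrefl' (a + c) ?_).elim
    nth_rw 2 [← h]; rw [← add_assoc]; exact lt_add_succ' _ _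

end Arith

open Arith

instance : IsOrderedAddMonoid M.Num where
  add_le_add_left a b h c := by
    obtain ⟨d, rfl⟩ := exists_of_le h
    rw [add_right_comm]
    exact le_add_right' _ _

instance : CanonicallyOrderedAdd M.Num where
  exists_add_of_le h := exists_of_le h
  le_add_self a b := by rw [add_comm]; exact le_add_right' a b
  le_self_add := le_add_right'

instance : Nontrivial M.Num := ⟨0, 1, fun h => hM.out.basic.succ_ne_zero 0 (by rw [zero_add, h])⟩

instance : IsStrictOrderedRing M.Num where
  le_of_add_le_add_left a b c h := by
    obtain ⟨d, h⟩ := exists_of_le h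
    rw [add_assoc] at h
    rw [add_left_cancel' h]
    exact le_add_right' _ _
  zero_le_one := zero_le
  mul_lt_mul_of_pos_left a ha b c h := by
    obtain ⟨d, rfl⟩ := exists_of_lt' h
    obtain ⟨e, rfl⟩ := exists_of_lt' ha
    exact lt_iff'.2 ⟨e * (d + 1) + d, by ring⟩
  mul_lt_mul_of_pos_right a ha b c h := by
    obtain ⟨d, rfl⟩ := exists_of_lt' h
    obtain ⟨e, rfl⟩ := exists_of_lt' ha
    exact lt_iff'.2 ⟨e * (d + 1) + d, by ring⟩

namespace Arith

theorem add_one_le_iff {a b : M.Num} : a + 1 ≤ b ↔ a < b := by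
  rw [← lt_add_one_iff, add_lt_add_iff_right]

theorem numeral_eq (k : ℕ) : M.numeral k = (k : M.Num) := by
  induction k with
  | zero => exact Nat.cast_zero.symm
  | succ k ih => rw [L2Structure.numeral, ih, Nat.cast_succ]

end Arith

/-! ### Boundedly definable functions -/

/-- Functions that are bounded by a term and have a graph defined by a bounded formula. -/
class BFun (f : (ℕ → M.Num) → M.Num) : Prop where
  bound : ∃ g, Tm g ∧ ∀ v, f v ≤ g v
  graph : Dfn True fun v => v 0 = f fun i => v (i + 1)

open Arith

instance BFun.of_tm (f : (ℕ → M.Num) → M.Num) [h : Tm f] : BFun f where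
  bound := ⟨f, h, fun _ => le_rfl⟩
  graph := have := Tm.tail f; inferInstance

theorem BFun.tail (f : (ℕ → M.Num) → M.Num) [h : BFun f] : BFun fun v => f fun i => v (i + 1) where
  bound := by
    obtain ⟨g, hg, h⟩ := h.bound
    exact ⟨_, Tm.tail g, fun v => h _⟩
  graph := h.graph.comp True (push 0 fun i => i + 2)

/-- The value `f v` is introduced by a bounded quantifier, `∃ a ≤ g v` with `a = f v`, so
substitution preserves boundedness. Quotients, remainders and digits can thus occur in bounded
formulas. -/
theorem Dfn.subst (b : Prop) (f : (ℕ → M.Num) → M.Num) (P : M.Num → (ℕ → M.Num) → Prop)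
    [hf : BFun f] [hP : Dfn b fun v => P (v 0) fun i => v (i + 1)] : Dfn b fun v => P (f v) v := by
  obtain ⟨⟨g, hg, h⟩, h'⟩ := hf
  have := Dfn.of_bounded (P := fun v => v 0 = f fun i => v (i + 1)) b
  refine Dfn.congr (P := fun v => ∃ a, a < g v + 1 ∧ a = f v ∧ P a v) inferInstance fun v => ?_
  constructor
  · rintro ⟨_, _, rfl, h⟩; exact h
  · exact fun hP => ⟨_, lt_add_one_iff.2 (h v), rfl, hP⟩

theorem Dfn.subst₂ (b : Prop) (P : M.Num → M.Num → Prop) (f g : (ℕ → M.Num) → M.Num)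
    [hP : Dfn b fun v => P (v 1) (v 0)] [BFun f] [BFun g] : Dfn b fun v => P (f v) (g v) := by
  have := BFun.tail g
  have : Dfn b fun v => P (v 0) (g fun i => v (i + 1)) :=
    Dfn.subst b (fun v => g fun i => v (i + 1)) fun a v => P (v 0) a
  exact Dfn.subst b f fun a v => P a (g v)

theorem BFun.subst₂ (F : M.Num → M.Num → M.Num) (f g : (ℕ → M.Num) → M.Num)
    [hF : Dfn True fun v => v 2 = F (v 1) (v 0)] [BFun f] [BFun g]
    (hb : ∃ h, Tm h ∧ ∀ v, F (f v) (g v) ≤ h v) : BFun fun v => F (f v) (g v) where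
  bound := hb
  graph := by
    have hf := BFun.tail f
    have := BFun.tail g
    have := BFun.tail fun v => g fun i => v (i + 1)
    have : Dfn True fun v => v 1 = F (v 0) (g fun i => v (i + 1 + 1)) :=
      have : Dfn True fun v : ℕ → M.Num => v 2 = F (v 1) (v 0) := hF
      Dfn.subst True (fun v => g fun i => v (i + 1 + 1)) fun a v => v 1 = F (v 0) a
    exact Dfn.subst True (fun v => f fun i => v (i + 1))
      fun a v => v 0 = F a (g fun i => v (i + 1))

section instances

variable (b : Prop) (f g : (ℕ → M.Num) → M.Num) [hf : BFun f] [hg : BFun g]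

instance BFun.add : BFun fun v => f v + g v :=
  BFun.subst₂ (· + ·) f g <| by
    obtain ⟨s, hs, h⟩ := hf.bound
    obtain ⟨t, ht, h'⟩ := hg.bound
    exact ⟨fun v => s v + t v, inferInstance, fun v => add_le_add (h v) (h' v)⟩

instance BFun.mul : BFun fun v => f v * g v :=
  BFun.subst₂ (· * ·) f g <| by
    obtain ⟨s, hs, h⟩ := hf.bound
    obtain ⟨t, ht, h'⟩ := hg.bound
    exact ⟨fun v => s v * t v, inferInstance, fun v => mul_le_mul' (h v) (h' v)⟩

instance BFun.pair : BFun fun v => M.pair (f v) (g v) :=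
  inferInstanceAs (BFun fun v => (f v + g v) * (f v + g v) + f v)

instance Dfn.eq : Dfn b fun v => f v = g v := Dfn.subst₂ b (fun x y => x = y) f g

instance Dfn.lt : Dfn b fun v => f v < g v := Dfn.subst₂ b (fun x y => x < y) f g

instance Dfn.le : Dfn b fun v => f v ≤ g v :=
  inferInstanceAs (Dfn b fun v => f v < g v ∨ f v = g v)

instance Dfn.mem (X : Set M.Num) [IsSet X] : Dfn b fun v => f v ∈ X :=
  Dfn.subst b f fun a _ => a ∈ X

instance Dfn.const (p : Prop) : Dfn b fun _ : ℕ → M.Num => p := by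
  by_cases h : p
  · exact Dfn.congr (P := fun v => v 0 = v 0) inferInstance fun _ => by simp [h]
  · exact Dfn.congr (P := fun v => ¬ v 0 = v 0) inferInstance fun _ => by simp [h]

instance Dfn.ballLt (P : M.Num → (ℕ → M.Num) → Prop)
    [hP : Dfn b fun v => P (v 0) fun i => v (i + 1)] :
    Dfn b fun v => ∀ a, a < f v → P a v := by
  obtain ⟨g, hg, h⟩ := hf.bound
  have := BFun.tail f
  refine Dfn.congr (P := fun v => ∀ a, a < g v → a < f v → P a v) inferInstance fun v => ?_
  exact ⟨fun h' a ha => h' a (ha.trans_le (h v)) ha, fun h' a _ ha => h' a ha⟩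

instance Dfn.bexLt (P : M.Num → (ℕ → M.Num) → Prop)
    [hP : Dfn b fun v => P (v 0) fun i => v (i + 1)] :
    Dfn b fun v => ∃ a, a < f v ∧ P a v := by
  obtain ⟨g, hg, h⟩ := hf.bound
  have := BFun.tail f
  refine Dfn.congr (P := fun v => ∃ a, a < g v ∧ a < f v ∧ P a v) inferInstance fun v => ?_
  exact ⟨fun ⟨a, _, h⟩ => ⟨a, h⟩, fun ⟨a, ha, h'⟩ => ⟨a, ha.trans_le (h v), ha, h'⟩⟩

instance Dfn.ballLe (P : M.Num → (ℕ → M.Num) → Prop)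
    [hP : Dfn b fun v => P (v 0) fun i => v (i + 1)] :
    Dfn b fun v => ∀ a, a ≤ f v → P a v :=
  Dfn.congr (P := fun v => ∀ a, a < f v + 1 → P a v) inferInstance
    fun v => by simp only [lt_add_one_iff]

instance Dfn.bexLe (P : M.Num → (ℕ → M.Num) → Prop)
    [hP : Dfn b fun v => P (v 0) fun i => v (i + 1)] :
    Dfn b fun v => ∃ a, a ≤ f v ∧ P a v :=
  Dfn.congr (P := fun v => ∃ a, a < f v + 1 ∧ P a v) inferInstance
    fun v => by simp only [lt_add_one_iff]

instance Dfn.dvd : Dfn b fun v => f v ∣ g v := by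
  refine Dfn.subst₂ b (fun x y => x ∣ y) f g
    (hP := Dfn.congr (P := fun v => ∃ c, c ≤ v 0 ∧ v 0 = v 1 * c) inferInstance fun v => ?_)
  constructor
  · rintro ⟨c, _, h⟩; exact ⟨c, h⟩
  · rintro ⟨c, h⟩
    rcases eq_or_ne (v 1) 0 with h1 | h1
    -- For divisor `0` the given cofactor need not respect the bound, so it is replaced by `0`.
    · exact ⟨0, zero_le, by rw [h, h1, zero_mul, zero_mul]⟩
    · refine ⟨c, ?_, h⟩
      rw [h]
      exact le_mul_of_one_le_left' (by rwa [← zero_add (1 : M.Num), add_one_le_iff, pos_iff_ne_zero])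

end instances

/-! ### Induction principles -/

theorem bdd_strong_induction {P : M.Num → Prop} [hP : Dfn True fun v => P (v 0)]
    (h : ∀ n, (∀ m, m < n → P m) → P n) (n : M.Num) : P n := by
  have := hP
  refine h n (bdd_induction (P := fun n => ∀ m, m < n → P m) ?_ (fun n ih m hm => ?_) n)
  · exact fun m hm => (not_lt_zero hm).elim
  · rcases (lt_add_one_iff.1 hm).lt_or_eq with h' | rfl
    exacts [ih m h', h m ih]

/-- Without a least element every solution yields a smaller one. Induction on `k` then gives
solutions `m` with `m + k ≤ n`, absurd for `k = n + 1`. A single `t` bounds both `m` and its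
witness, which keeps the induction statement `Σ⁰₁`. -/
theorem sigma_least {P : M.Num → M.Num → Prop} [hP : Dfn True fun v => P (v 1) (v 0)]
    (h : ∃ n m, P n m) : ∃ n, (∃ m, P n m) ∧ ∀ k, k < n → ∀ m, ¬ P k m := by
  by_contra! hc
  obtain ⟨n, hn⟩ := h
  have : Dfn True fun v : ℕ → M.Num => P (v 0) (v 1) := Dfn.comp True (P := fun v => P (v 1) (v 0))
    (push 1 (push 0 fun i => i))
  suffices key : ∃ t, ∃ m, m ≤ t ∧ ∃ y, y ≤ t ∧ m + (n + 1) ≤ n ∧ P m y by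
    obtain ⟨t, m, hm, y, hy, h, -⟩ := key
    exact absurd (le_trans le_add_self h) (not_le.2 (lt_add_one_iff.2 le_rfl))
  refine sigma_induction
    (P := fun k t => ∃ m, m ≤ t ∧ ∃ y, y ≤ t ∧ m + k ≤ n ∧ P m y) ?_ ?_ (n + 1)
  · obtain ⟨m, h⟩ := hn
    exact ⟨n + m, n, le_self_add, m, le_add_self, (add_zero n).le, h⟩
  · rintro k ⟨t, m, hm, y, hy, h, hP⟩
    obtain ⟨m', hm', y', hP'⟩ := hc m ⟨y, hP⟩
    refine ⟨m' + y', m', le_self_add, y', le_add_self, le_trans ?_ h, hP'⟩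
    rw [add_comm k, ← add_assoc]
    exact add_le_add_left (add_one_le_iff.2 hm') k

namespace Arith

/-! ### Pairing -/

theorem le_mul_self (a : M.Num) : a ≤ a * a := by
  rcases eq_or_ne a 0 with rfl | h
  · exact zero_le
  · exact le_mul_of_one_le_left' (by rwa [← zero_add (1 : M.Num), add_one_le_iff, pos_iff_ne_zero])

theorem left_le_pair (x y : M.Num) : x ≤ M.pair x y := le_add_self

theorem right_le_pair (x y : M.Num) : y ≤ M.pair x y :=
  le_trans (le_trans le_add_self (le_mul_self (x + y))) le_self_add

/-- The codes of pairs with sum `s` lie between `s²` and `s² + s`, hence below `(s + 1)²`. -/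
theorem pair_lt_of_add_lt {x y x' y' : M.Num} (h : x + y < x' + y') :
    M.pair x y < M.pair x' y' := by
  have h1 : x + y + 1 ≤ x' + y' := add_one_le_iff.2 h
  have h2 : (x + y + 1) * (x + y + 1) ≤ M.pair x' y' :=
    le_trans (mul_le_mul' h1 h1) le_self_add
  have h3 : (x + y + 1) * (x + y + 1) = M.pair x y + (y + (x + y)) + 1 := by
    unfold L2Structure.pair; ring
  exact (lt_add_one_iff.2 le_self_add).trans_le (h3 ▸ h2)

theorem pair_inj {x y x' y' : M.Num} : M.pair x y = M.pair x' y' ↔ x = x' ∧ y = y' := by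
  refine ⟨fun h => ?_, fun ⟨h, h'⟩ => h ▸ h' ▸ rfl⟩
  rcases lt_trichotomy (x + y) (x' + y') with h1 | h1 | h1
  · exact absurd h (pair_lt_of_add_lt h1).ne
  · unfold L2Structure.pair at h
    rw [h1] at h
    have := add_left_cancel h
    subst this
    exact ⟨rfl, add_left_cancel h1⟩
  · exact absurd h (pair_lt_of_add_lt h1).ne'

theorem pair_mono {x y x' y' : M.Num} (h : x ≤ x') (h' : y ≤ y') : M.pair x y ≤ M.pair x' y' :=
  add_le_add (mul_le_mul' (add_le_add h h') (add_le_add h h')) h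

theorem exists_pairs (P : M.Num → M.Num → Prop) [hP : Dfn True fun v => P (v 1) (v 0)] :
    ∃ R : Set M.Num, IsSet R ∧ ∀ x y, M.pair x y ∈ R ↔ P x y := by
  have : Dfn True fun v : ℕ → M.Num => P (v 1) (v 0) := hP
  refine ⟨_, bdd_comprehension (P := fun z => ∃ x, x ≤ z ∧ ∃ y, y ≤ z ∧ z = M.pair x y ∧ P x y),
    fun x y => ⟨?_, fun h => ⟨x, left_le_pair x y, y, right_le_pair x y, rfl, h⟩⟩⟩
  rintro ⟨x', _, y', _, h, h'⟩
  obtain ⟨rfl, rfl⟩ := pair_inj.1 h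
  exact h'

/-! ### Divisibility -/

theorem dvd_of_dvd_add {a b c : M.Num} (h : a ∣ b) (h' : a ∣ b + c) : a ∣ c := by
  obtain ⟨k, rfl⟩ := h
  obtain ⟨l, h'⟩ := h'
  rcases eq_or_ne a 0 with rfl | ha
  · exact ⟨0, by simpa using h'⟩
  · have : k ≤ l := le_of_mul_le_mul_left (h' ▸ le_self_add) (pos_iff_ne_zero.2 ha)
    obtain ⟨d, rfl⟩ := exists_of_le this
    exact ⟨d, add_left_cancel (h'.trans (mul_add _ _ _))⟩

theorem le_of_dvd {a b : M.Num} (hb : b ≠ 0) (h : a ∣ b) : a ≤ b := by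
  obtain ⟨c, rfl⟩ := h
  refine le_mul_of_one_le_right' ?_
  rw [← zero_add (1 : M.Num), add_one_le_iff, pos_iff_ne_zero]
  exact right_ne_zero_of_mul hb

/-! ### Coprime moduli and strong bounding -/

theorem exists_multiple (b : M.Num) : ∃ L : M.Num, L ≠ 0 ∧ ∀ i, i ≤ b → i ≠ 0 → i ∣ L := by
  refine sigma_induction (P := fun b L : M.Num => ¬ L = 0 ∧ ∀ i, i ≤ b → ¬ i = 0 → i ∣ L)
    ⟨1, one_ne_zero, fun i h h' => (h' (le_antisymm h zero_le)).elim⟩ (fun b ⟨L, h, hL⟩ => ?_) b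
  refine ⟨L * (b + 1), mul_ne_zero h (by simp), fun i hi h0 => ?_⟩
  rcases hi.lt_or_eq with hi | rfl
  · exact (hL i (lt_add_one_iff.1 hi) h0).mul_right _
  · exact dvd_mul_left _ _

/-- The moduli `1 + (i + 1) * L`, used to code finite sets by their divisors. -/
def modulus (L i : M.Num) : M.Num := 1 + (i + 1) * L

instance (b : Prop) (f g h : (ℕ → M.Num) → M.Num) [BFun f] [BFun g] [BFun h] :
    Dfn b fun v => modulus (f v) (g v) ∣ h v :=
  inferInstanceAs (Dfn b fun v => 1 + (g v + 1) * f v ∣ h v)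

/-- Modulo `m` one has `a ≡ d`, so `m` divides `d * u` and therefore `J * L * u`. As `m * u = u + J
* L * u`, it divides `u`. -/
theorem dvd_of_modulus_dvd_mul_aux {L m d a b u : M.Num} (hd : d ∣ L) (hm : ∃ J, m = 1 + J * L)
    (hab : a = m * b + d) (h : m ∣ a * u) : m ∣ u := by
  obtain ⟨J, hJ⟩ := hm
  obtain ⟨e, rfl⟩ := hd
  have h1 : m ∣ d * u := by
    rw [hab, add_mul, mul_assoc] at h
    exact dvd_of_dvd_add (dvd_mul_right _ _) h
  refine dvd_of_dvd_add (b := d * u * (e * J)) (h1.mul_right _) ⟨u, ?_⟩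
  rw [hJ]; ring

/-- Coprimality of distinct moduli, phrased without gcds: `(i + 1) * modulus L j` and `(j + 1) *
modulus L i` differ by the distance of `i` and `j`, which divides `L`. -/
theorem dvd_of_modulus_dvd_mul {L b i j u : M.Num} (hL : ∀ i, i ≤ b → i ≠ 0 → i ∣ L) (hi : i < b)
    (hj : j < b) (hij : i ≠ j) (h : modulus L j ∣ modulus L i * u) : modulus L j ∣ u := by
  rcases hij.lt_or_gt with h' | h'
  · obtain ⟨d, rfl⟩ := exists_of_lt' h'
    refine dvd_of_modulus_dvd_mul_aux (d := d + 1) (a := modulus L i * (i + (d + 1) + 1))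
      (b := i + 1) (hL _ ?_ (by simp)) ⟨_, rfl⟩ ?_ (u := u) ?_
    · exact le_trans le_add_self hj.le
    · unfold modulus; ring
    · rw [mul_right_comm]; exact h.mul_right _
  · obtain ⟨d, rfl⟩ := exists_of_lt' h'
    have hd : d + 1 ∣ L := hL _ (le_trans le_add_self hi.le) (by simp)
    obtain ⟨e, he⟩ := hd
    have h1 : modulus L j ∣ (d + 1) * u := by
      refine dvd_of_dvd_add (b := modulus L (j + (d + 1)) * u * (j + 1)) (h.mul_right _)
        ⟨(j + (d + 1) + 1) * u, ?_⟩
      unfold modulus; ring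
    refine dvd_of_dvd_add (b := (d + 1) * u * (e * (j + 1))) (h1.mul_right _) ⟨u, ?_⟩
    unfold modulus; rw [he]; ring

theorem one_lt_modulus {L : M.Num} (hL : L ≠ 0) (i : M.Num) : 1 < modulus L i :=
  lt_add_of_pos_right _ (mul_pos (by simp) (pos_iff_ne_zero.2 hL))

theorem modulus_ne_zero (L i : M.Num) : modulus L i ≠ 0 := by
  simp [modulus]

theorem modulus_mono {L i j : M.Num} (h : i ≤ j) : modulus L i ≤ modulus L j := by
  unfold modulus; gcongr

/-- The strong bounding principle for a `Σ⁰₁` predicate. -/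
theorem strong_bounding (R : Set M.Num) [IsSet R] (b : M.Num) :
    ∃ s, ∀ i, i < b → ∀ y, M.pair i y ∈ R → ∃ y', y' < s ∧ M.pair i y' ∈ R := by
  obtain ⟨L, hL0, hL⟩ := exists_multiple b
  -- Take the least nonzero `u` divisible, for some stage `s`, by the moduli of all `i < b` without
  -- a witness below `s`. If such an `i` had a later witness, its modulus could be divided out of
  -- `u` at a later stage, contradicting minimality.
  obtain ⟨u, ⟨s, hu0, hu⟩, hmin⟩ := sigma_least (P := fun u s : M.Num => ¬ u = 0 ∧
      ∀ i, i < b → (¬ ∃ y, y < s ∧ M.pair i y ∈ R) → modulus L i ∣ u) <| by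
    obtain ⟨U, hU0, hU⟩ := exists_multiple (modulus L b)
    exact ⟨U, 0, hU0, fun i hi _ => hU _ (modulus_mono hi.le) (modulus_ne_zero _ _)⟩
  refine ⟨s, fun i hi y hy => ?_⟩
  by_contra hc
  obtain ⟨u', rfl⟩ := hu i hi hc
  have hu' : u' ≠ 0 := right_ne_zero_of_mul hu0
  refine hmin u' ?_ (s + (y + 1)) ⟨hu', fun j hj hw => ?_⟩
  · exact lt_mul_of_one_lt_left (pos_iff_ne_zero.2 hu') (one_lt_modulus hL0 i)
  · have hij : i ≠ j := by
      rintro rfl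
      exact hw ⟨y, lt_of_lt_of_le (lt_add_one_iff.2 le_rfl) le_add_self, hy⟩
    refine dvd_of_modulus_dvd_mul hL hi hj hij (hu j hj fun ⟨z, hz, hz'⟩ => hw ⟨z, ?_, hz'⟩)
    exact hz.trans_le le_self_add

/-! ### Division with remainder -/

theorem exists_div_mod (n : M.Num) {p : M.Num} (hp : p ≠ 0) : ∃ q r, r < p ∧ n = p * q + r := by
  suffices ∃ q, q ≤ n ∧ ∃ r, r < p ∧ n = p * q + r from
    let ⟨q, _, r, h⟩ := this; ⟨q, r, h⟩
  refine bdd_induction (P := fun n => ∃ q, q ≤ n ∧ ∃ r, r < p ∧ n = p * q + r) ?_ ?_ n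
  · exact ⟨0, le_rfl, 0, pos_iff_ne_zero.2 hp, by simp⟩
  · rintro n ⟨q, hq, r, hr, h⟩
    rcases (add_one_le_iff.2 hr).lt_or_eq with h' | h'
    · exact ⟨q, hq.trans le_self_add, r + 1, h', by rw [h, add_assoc]⟩
    · exact ⟨q + 1, add_le_add_left hq 1, 0, pos_iff_ne_zero.2 hp, by rw [h, add_assoc, h']; ring⟩

theorem div_mod_unique' {p q r q' r' : M.Num} (hr : r < p) (hr' : r' < p)
    (h : p * q + r = p * q' + r') : q = q' := by
  have key {q r q' r' : M.Num} (hr : r < p) (h : p * q + r = p * q' + r') : ¬ q < q' := by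
    intro hq
    have h1 : p * (q + 1) ≤ p * q' := mul_le_mul_right (add_one_le_iff.2 hq) p
    have h2 : p * q + r < p * q' := lt_of_lt_of_le (by rw [mul_add, mul_one]; gcongr) h1
    exact (h2.trans_le le_self_add).ne h
  exact le_antisymm (not_lt.1 (key hr' h.symm)) (not_lt.1 (key hr h))

end Arith

open Arith

open Classical in
noncomputable instance : Div M.Num :=
  ⟨fun n p => if h : p ≠ 0 then (exists_div_mod n h).choose else 0⟩

-- The value at modulus `0` is `0`, unlike the usual convention `n % 0 = n`.
open Classical in
noncomputable instance : Mod M.Num :=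
  ⟨fun n p => if h : p ≠ 0 then (exists_div_mod n h).choose_spec.choose else 0⟩

namespace Arith

theorem div_mod_spec (n : M.Num) {p : M.Num} (hp : p ≠ 0) :
    n % p < p ∧ n = p * (n / p) + n % p := by
  have := (exists_div_mod n hp).choose_spec.choose_spec
  change (dite _ _ _ : M.Num) < p ∧ n = p * (dite _ _ _ : M.Num) + (dite _ _ _ : M.Num)
  rwa [dif_pos hp, dif_pos hp]

theorem mod_lt (n : M.Num) {p : M.Num} (hp : p ≠ 0) : n % p < p := (div_mod_spec n hp).1

theorem eq_div_mod (n : M.Num) {p : M.Num} (hp : p ≠ 0) : n = p * (n / p) + n % p :=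
  (div_mod_spec n hp).2

theorem div_zero' (n : M.Num) : n / 0 = 0 := by
  change (dite _ _ _ : M.Num) = 0
  rw [dif_neg (by simp)]

theorem mod_zero' (n : M.Num) : n % 0 = 0 := by
  change (dite _ _ _ : M.Num) = 0
  rw [dif_neg (by simp)]

theorem div_mod_unique {n p q r : M.Num} (hr : r < p) (h : n = p * q + r) :
    n / p = q ∧ n % p = r := by
  have hp : p ≠ 0 := (zero_le.trans_lt hr).ne'
  have h' := eq_div_mod n hp
  have := div_mod_unique' (mod_lt n hp) hr (h'.symm.trans h)
  refine ⟨this, ?_⟩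
  rw [this] at h'
  exact add_left_cancel (h'.symm.trans h)

theorem mod_le (n p : M.Num) : n % p ≤ n := by
  rcases eq_or_ne p 0 with rfl | hp
  · rw [mod_zero']; exact zero_le
  · nth_rw 2 [eq_div_mod n hp]; exact le_add_self

theorem div_le (n p : M.Num) : n / p ≤ n := by
  rcases eq_or_ne p 0 with rfl | hp
  · rw [div_zero']; exact zero_le
  · nth_rw 2 [eq_div_mod n hp]
    refine le_trans (le_mul_of_one_le_left' ?_) le_self_add
    rwa [← zero_add (1 : M.Num), add_one_le_iff, pos_iff_ne_zero]

/-- A bounded description of the graph of division, as `BFun.div` requires. -/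
theorem eq_quot_iff {p q n : M.Num} : q = n / p ↔
    (p = 0 ∧ q = 0) ∨ ∃ r, r < p ∧ n = p * q + r := by
  constructor
  · rintro rfl
    rcases eq_or_ne p 0 with rfl | hp
    · exact .inl ⟨rfl, div_zero' _⟩
    · exact .inr ⟨_, div_mod_spec n hp⟩
  · rintro (⟨rfl, rfl⟩ | ⟨r, hr, h⟩)
    · exact (div_zero' _).symm
    · exact (div_mod_unique hr h).1.symm

theorem eq_mod_iff {p r n : M.Num} : r = n % p ↔
    (p = 0 ∧ r = 0) ∨ (r < p ∧ ∃ q, q ≤ n ∧ n = p * q + r) := by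
  constructor
  · rintro rfl
    rcases eq_or_ne p 0 with rfl | hp
    · exact .inl ⟨rfl, mod_zero' _⟩
    · exact .inr ⟨mod_lt n hp, _, div_le n p, eq_div_mod n hp⟩
  · rintro (⟨rfl, rfl⟩ | ⟨hr, q, _, h⟩)
    · exact (mod_zero' _).symm
    · exact (div_mod_unique hr h).2.symm

end Arith

instance BFun.div (f g : (ℕ → M.Num) → M.Num) [hf : BFun f] [hg : BFun g] :
    BFun fun v => f v / g v :=
  BFun.subst₂ (· / ·) f g (hF := by simp only [eq_quot_iff]; infer_instance) <| by
    obtain ⟨s, hs, h⟩ := hf.bound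
    exact ⟨s, hs, fun v => (div_le _ _).trans (h v)⟩

instance BFun.mod (f g : (ℕ → M.Num) → M.Num) [hf : BFun f] [hg : BFun g] :
    BFun fun v => f v % g v :=
  BFun.subst₂ (· % ·) f g (hF := by simp only [eq_mod_iff]; infer_instance) <| by
    obtain ⟨s, hs, h⟩ := hf.bound
    exact ⟨s, hs, fun v => (mod_le _ _).trans (h v)⟩

theorem Dfn.subst₃ (b : Prop) (P : M.Num → M.Num → M.Num → Prop) (f g h : (ℕ → M.Num) → M.Num)
    [hP : Dfn b fun v => P (v 2) (v 1) (v 0)] [BFun f] [BFun g] [BFun h] :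
    Dfn b fun v => P (f v) (g v) (h v) := by
  have := BFun.tail g
  have := BFun.tail h
  have := BFun.tail fun v => h fun i => v (i + 1)
  have : Dfn b fun v => P (v 1) (v 0) (h fun i => v (i + 1 + 1)) :=
    Dfn.subst b (fun v => h fun i => v (i + 1 + 1)) fun a v => P (v 1) (v 0) a
  have : Dfn b fun v => P (v 0) (g fun i => v (i + 1)) (h fun i => v (i + 1)) :=
    Dfn.subst b (fun v => g fun i => v (i + 1)) fun a v => P (v 0) a (h fun i => v (i + 1))
  exact Dfn.subst b f fun a v => P a (g v) (h v)

namespace Arith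

/-! ### Powers of three -/

/-- `p` is a power of three. -/
def Pow3 (p : M.Num) : Prop := ¬ p = 0 ∧ ∀ d, d ≤ p → d ∣ p → d = 1 ∨ 3 ∣ d

instance (b : Prop) (f : (ℕ → M.Num) → M.Num) [BFun f] : Dfn b fun v => Pow3 (f v) :=
  have : Dfn b fun v : ℕ → M.Num => Pow3 (v 0) := by unfold Pow3; infer_instance
  Dfn.subst b f fun a _ => Pow3 a

theorem three_ne_zero' : (3 : M.Num) ≠ 0 := by norm_num

theorem lt_three_iff {r : M.Num} : r < 3 ↔ r = 0 ∨ r = 1 ∨ r = 2 := by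
  rw [show (3 : M.Num) = 0 + 1 + 1 + 1 by norm_num, lt_add_one_iff, le_iff_lt_or_eq,
    lt_add_one_iff, le_iff_lt_or_eq, lt_add_one_iff, nonpos_iff_eq_zero, or_assoc,
    show (0 + 1 : M.Num) = 1 by norm_num, show (1 + 1 : M.Num) = 2 by norm_num]

theorem lt_two_iff {r : M.Num} : r < 2 ↔ r = 0 ∨ r = 1 := by
  rw [show (2 : M.Num) = 0 + 1 + 1 by norm_num, lt_add_one_iff, le_iff_lt_or_eq,
    lt_add_one_iff, nonpos_iff_eq_zero, show (0 + 1 : M.Num) = 1 by norm_num]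

theorem dvd_iff_mod_eq_zero {p n : M.Num} (hp : p ≠ 0) : p ∣ n ↔ n % p = 0 := by
  refine ⟨fun ⟨k, h⟩ => (div_mod_unique (pos_iff_ne_zero.2 hp) (by rw [h, add_zero])).2,
    fun h => ⟨n / p, ?_⟩⟩
  have := eq_div_mod n hp
  rwa [h, add_zero] at this

theorem three_prime {a b : M.Num} (h : 3 ∣ a * b) : 3 ∣ a ∨ 3 ∣ b := by
  have h3 := three_ne_zero' (M := M)
  rw [dvd_iff_mod_eq_zero h3] at *
  have ha := eq_div_mod a h3
  have hb := eq_div_mod b h3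
  have h1 : (1 : M.Num) < 3 := by norm_num
  have h2 : (2 : M.Num) < 3 := by norm_num
  rw [dvd_iff_mod_eq_zero h3]
  rcases lt_three_iff.1 (mod_lt a h3) with e | e | e
  · exact .inl e
  all_goals
    rcases lt_three_iff.1 (mod_lt b h3) with e' | e' | e'
    · exact .inr e'
    all_goals
      exfalso
      rw [e] at ha
      rw [e'] at hb
      generalize a / 3 = x at ha
      generalize b / 3 = y at hb
      subst ha hb
  · refine one_ne_zero ((div_mod_unique (q := 3 * x * y + x + y) h1 ?_).2.symm.trans h); ring
  · refine two_ne_zero ((div_mod_unique (q := 3 * x * y + 2 * x + y) h2 ?_).2.symm.trans h); ring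
  · refine two_ne_zero ((div_mod_unique (q := 3 * x * y + x + 2 * y) h2 ?_).2.symm.trans h); ring
  · refine one_ne_zero
      ((div_mod_unique (q := 3 * x * y + 2 * x + 2 * y + 1) h1 ?_).2.symm.trans h); ring

theorem pow3_one : Pow3 (1 : M.Num) :=
  ⟨one_ne_zero, fun d h hd => .inl (le_antisymm h (by
    rw [← zero_add (1 : M.Num), add_one_le_iff, pos_iff_ne_zero]
    rintro rfl
    exact one_ne_zero (zero_dvd_iff.1 hd)))⟩

theorem Pow3.eq_one_or {p d : M.Num} (hp : Pow3 p) (h : d ∣ p) : d = 1 ∨ 3 ∣ d :=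
  hp.2 d (le_of_dvd hp.1 h) h

theorem Pow3.of_dvd {p d : M.Num} (hp : Pow3 p) (h : d ∣ p) : Pow3 d := by
  refine ⟨?_, fun e _ he => hp.eq_one_or (he.trans h)⟩
  rintro rfl
  exact hp.1 (zero_dvd_iff.1 h)

theorem Pow3.mul_three {p : M.Num} (hp : Pow3 p) : Pow3 (p * 3) := by
  refine ⟨mul_ne_zero hp.1 three_ne_zero', fun d _ hd => ?_⟩
  by_cases h : 3 ∣ d
  · exact .inr h
  · obtain ⟨c, hc⟩ := hd
    have h3 : (3 : M.Num) ∣ d * c := hc ▸ dvd_mul_left _ _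
    obtain ⟨c', rfl⟩ := (three_prime h3).resolve_left h
    refine hp.eq_one_or ⟨c', mul_right_cancel₀ three_ne_zero' ?_⟩
    rw [hc]; ring

/-- Replaces induction on the exponent; it is strong induction on the power itself. -/
theorem pow3_induction {P : M.Num → Prop} [Dfn True fun v => P (v 0)] (h1 : P 1)
    (hs : ∀ p, Pow3 p → P p → P (p * 3)) {p : M.Num} (hp : Pow3 p) : P p := by
  refine bdd_strong_induction (P := fun p => Pow3 p → P p) (fun p ih hp => ?_) p hp
  rcases hp.eq_one_or dvd_rfl with rfl | ⟨c, rfl⟩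
  · exact h1
  · have hc : Pow3 c := hp.of_dvd (dvd_mul_left _ _)
    rw [mul_comm]
    refine hs c hc (ih c ?_ hc)
    exact lt_mul_of_one_lt_left (pos_iff_ne_zero.2 hc.1) (by norm_num)

theorem Pow3.dvd_or_dvd {p q : M.Num} (hp : Pow3 p) (hq : Pow3 q) : p ∣ q ∨ q ∣ p := by
  refine pow3_induction (P := fun p => p ∣ q ∨ q ∣ p) (.inl (one_dvd q)) (fun p _ h => ?_) hp
  rcases h with ⟨t, h⟩ | h
  · rcases hq.eq_one_or (h ▸ dvd_mul_left t p) with rfl | ⟨s, rfl⟩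
    · exact .inr ⟨3, by rw [h, mul_one]⟩
    · exact .inl ⟨s, by rw [h, mul_assoc]⟩
  · exact .inr (h.mul_right _)

theorem Pow3.mul_three_dvd {p q : M.Num} (hp : Pow3 p) (hq : Pow3 q) (h : p < q) : p * 3 ∣ q := by
  rcases hp.dvd_or_dvd hq with ⟨t, rfl⟩ | h'
  · rcases hq.eq_one_or (dvd_mul_left t p) with rfl | h3
    · exact absurd h (by simp)
    · exact mul_dvd_mul_left _ h3
  · exact absurd (le_of_dvd hp.1 h') (not_le.2 h)

theorem exists_pow3_gt (n : M.Num) : ∃ p, Pow3 p ∧ n < p := by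
  refine sigma_induction (P := fun n p : M.Num => Pow3 p ∧ n < p) ⟨1, pow3_one, by simp⟩
    (fun n ⟨p, hp, h⟩ => ⟨p * 3, hp.mul_three, ?_⟩) n
  refine lt_of_le_of_lt (add_one_le_iff.2 h) ?_
  exact lt_mul_of_one_lt_right (pos_iff_ne_zero.2 hp.1) (by norm_num)

-- Adding a power of three therefore flips parity, which is how the parity of a `Code` counts
-- important places.
theorem Pow3.odd {p : M.Num} (hp : Pow3 p) : p % 2 = 1 := by
  have h2 : (2 : M.Num) ≠ 0 := by norm_num
  have h12 : (1 : M.Num) < 2 := by norm_num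
  refine pow3_induction (P := fun p : M.Num => p % 2 = 1) ?_ (fun p _ h => ?_) hp
  · exact (div_mod_unique (q := 0) h12 (by simp)).2
  · have := eq_div_mod p h2
    rw [h] at this
    refine (div_mod_unique (q := 3 * (p / 2) + 1) h12 ?_).2
    generalize p / 2 = k at this ⊢
    rw [this]; ring

/-! ### Ternary digits -/

/-- The ternary digit of `n` at the place of the power `p` of three. -/
noncomputable def digit (n p : M.Num) : M.Num := n / p % 3

instance (f g : (ℕ → M.Num) → M.Num) [BFun f] [BFun g] : BFun fun v => digit (f v) (g v) :=
  inferInstanceAs (BFun fun v => f v / g v % 3)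

theorem digit_lt (n p : M.Num) : digit n p < 3 := mod_lt _ three_ne_zero'

theorem mod_mul_three (n : M.Num) {p : M.Num} (hp : p ≠ 0) :
    n % (p * 3) = n % p + p * digit n p := by
  refine (div_mod_unique (q := n / p / 3) ?_ ?_).2
  · have := add_one_le_iff.2 (digit_lt n p)
    calc n % p + p * digit n p < p + p * digit n p := by gcongr; exact mod_lt n hp
      _ = p * (digit n p + 1) := by ring
      _ ≤ p * 3 := mul_le_mul_right this p
  · have h1 := eq_div_mod n hp
    have h2 := eq_div_mod (n / p) (three_ne_zero' (M := M))
    unfold digit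
    nth_rw 1 [h1, h2]
    ring

theorem mod_add_mul (n k : M.Num) {p : M.Num} (hp : p ≠ 0) : (n + p * k) % p = n % p := by
  refine (div_mod_unique (q := n / p + k) (mod_lt n hp) ?_).2
  nth_rw 1 [eq_div_mod n hp]; ring

theorem div_add_mul (n k : M.Num) {p : M.Num} (hp : p ≠ 0) : (n + p * k) / p = n / p + k := by
  refine (div_mod_unique (q := n / p + k) (mod_lt n hp) ?_).1
  nth_rw 1 [eq_div_mod n hp]; ring

theorem mod_eq_self {n p : M.Num} (h : n < p) : n % p = n :=
  (div_mod_unique (q := 0) h (by simp)).2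

theorem div_eq_zero {n p : M.Num} (h : n < p) : n / p = 0 :=
  (div_mod_unique (q := 0) h (by simp)).1

theorem digit_eq_zero {n p : M.Num} (h : n < p) : digit n p = 0 := by
  rw [digit, div_eq_zero h]; exact mod_eq_self (by norm_num)

theorem digit_add_mul_three (n k : M.Num) {p : M.Num} (hp : p ≠ 0) :
    digit (n + p * 3 * k) p = digit n p := by
  rw [digit, mul_assoc, div_add_mul _ _ hp, mod_add_mul _ _ three_ne_zero', digit]

/-- Two numbers with the same ternary digits are equal. -/
theorem eq_of_digit_eq {a b : M.Num} (h : ∀ p, Pow3 p → digit a p = digit b p) : a = b := by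
  obtain ⟨p, hp, hlt⟩ := exists_pow3_gt (a + b)
  have : a % p = b % p := by
    refine pow3_induction (P := fun p => a % p = b % p) ?_ (fun p hp ih => ?_) hp
    · have (n : M.Num) : n % 1 = 0 := (div_mod_unique (q := n) (by simp) (by simp)).2
      rw [this, this]
    · rw [mod_mul_three _ hp.1, mod_mul_three _ hp.1, ih, h p hp]
  rwa [mod_eq_self (le_self_add.trans_lt hlt), mod_eq_self (le_add_self.trans_lt hlt)] at this

/-- `p` is the largest power of three that divides `n`. -/
def Low (n p : M.Num) : Prop := Pow3 p ∧ p ∣ n ∧ ¬ p * 3 ∣ n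

instance (b : Prop) (f g : (ℕ → M.Num) → M.Num) [BFun f] [BFun g] :
    Dfn b fun v => Low (f v) (g v) :=
  inferInstanceAs (Dfn b fun v => Pow3 (g v) ∧ g v ∣ f v ∧ ¬ g v * 3 ∣ f v)

theorem exists_low {n : M.Num} (hn : n ≠ 0) : ∃ p, Low n p := by
  by_contra! hc
  obtain ⟨p, hp, h⟩ := exists_pow3_gt n
  have : p ∣ n := pow3_induction (P := fun p => p ∣ n) (one_dvd n)
    (fun p hp h => by by_contra h'; exact hc p ⟨hp, h, h'⟩) hp
  exact absurd (le_of_dvd hn this) (not_le.2 h)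

theorem Low.ne_zero {n p : M.Num} (h : Low n p) : n ≠ 0 := by
  rintro rfl; exact h.2.2 (dvd_zero _)

theorem Low.le {n p : M.Num} (h : Low n p) : p ≤ n := le_of_dvd h.ne_zero h.2.1

theorem Low.unique {n p q : M.Num} (h : Low n p) (h' : Low n q) : p = q := by
  rcases lt_trichotomy p q with hl | hl | hl
  · exact (h.2.2 ((h.1.mul_three_dvd h'.1 hl).trans h'.2.1)).elim
  · exact hl
  · exact (h'.2.2 ((h'.1.mul_three_dvd h.1 hl).trans h.2.1)).elim

theorem low_iff_digit {n p : M.Num} (hp : Pow3 p) (h : p ∣ n) : Low n p ↔ digit n p ≠ 0 := by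
  obtain ⟨k, rfl⟩ := h
  have : digit (p * k) p = k % 3 := by
    rw [digit, ← zero_add (p * k), div_add_mul _ _ hp.1, div_eq_zero (pos_iff_ne_zero.2 hp.1),
      zero_add]
  rw [this, ne_eq, ← dvd_iff_mod_eq_zero three_ne_zero', Low, mul_dvd_mul_iff_left hp.1]
  exact ⟨fun h => h.2.2, fun h => ⟨hp, dvd_mul_right _ _, h⟩⟩

theorem Low.add_of_lt {n m p q : M.Num} (h : Low n p) (h' : Low m q) (hpq : p < q) :
    Low (n + m) p := by
  have h3 : p * 3 ∣ m := (h.1.mul_three_dvd h'.1 hpq).trans h'.2.1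
  refine ⟨h.1, dvd_add h.2.1 ((dvd_mul_right _ _).trans h3), fun hd => h.2.2 ?_⟩
  rw [add_comm] at hd
  exact dvd_of_dvd_add h3 hd

/-- Doubling exchanges the residues 1 and 2 modulo 3. This is the reason for base three. -/
theorem Low.digit_add_ne {n m p : M.Num} (h : Low n p) (h' : Low m p)
    (e : digit n p = digit m p) : Low (n + m) p ∧ digit (n + m) p ≠ digit n p := by
  have hp := h.1
  obtain ⟨k, hk⟩ := h.2.1
  obtain ⟨l, hl⟩ := h'.2.1
  have hn := (low_iff_digit hp h.2.1).1 h
  rw [low_iff_digit hp (dvd_add h.2.1 h'.2.1)]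
  have h3 := three_ne_zero' (M := M)
  have hkd : n / p = k := (div_mod_unique (pos_iff_ne_zero.2 hp.1) (by rw [hk, add_zero])).1
  have hld : m / p = l := (div_mod_unique (pos_iff_ne_zero.2 hp.1) (by rw [hl, add_zero])).1
  have hs : (n + m) / p = k + l := by rw [hl, div_add_mul _ _ hp.1, hkd]
  have hk3 := eq_div_mod k h3
  have hl3 := eq_div_mod l h3
  have h1 : (1 : M.Num) < 3 := by norm_num
  have h2 : (2 : M.Num) < 3 := by norm_num
  unfold digit at *
  rw [hkd, hld] at e
  rw [hs, hkd]
  rw [← e] at hl3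
  rcases lt_three_iff.1 (mod_lt k h3) with e1 | e1 | e1
  · exact (hn (hkd ▸ e1)).elim
  · rw [e1] at hk3 hl3 ⊢
    have : (k + l) % 3 = 2 := by
      refine (div_mod_unique (q := k / 3 + l / 3) h2 ?_).2
      nth_rw 1 [hk3, hl3]; ring
    rw [this]; norm_num
  · rw [e1] at hk3 hl3 ⊢
    have : (k + l) % 3 = 1 := by
      refine (div_mod_unique (q := k / 3 + l / 3 + 1) h1 ?_).2
      nth_rw 1 [hk3, hl3]; ring
    rw [this]; norm_num

end Arith

/-! ### The colouring -/

namespace Coloring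

variable (R : Set M.Num)

/-- `x` is enumerated before stage `s`: some `y < s` satisfies `R x y`. -/
def Enum (x s : M.Num) : Prop := ∃ y, y < s ∧ M.pair x y ∈ R

theorem Enum.mono {R : Set M.Num} {x s t : M.Num} (h : Enum R x s) (hst : s ≤ t) : Enum R x t :=
  h.imp fun _ h => ⟨h.1.trans_le hst, h.2⟩

/-- The place `p` is important in `n` (relative to `l`): `n` has a nonzero digit at `p` but not only
there and above, and some `x < l` is enumerated between the stages `n % p` and `p`. -/
def Important (l n p : M.Num) : Prop :=
  ¬ n % p = 0 ∧ ¬ digit n p = 0 ∧ ∃ x, x < l ∧ Enum R x p ∧ ¬ Enum R x (n % p)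

/-- `i` has digit `1` at the important places of `n`, and digit `0` elsewhere. -/
def Code (l n i : M.Num) : Prop :=
  i ≤ n ∧ ∀ p, p ≤ n → Pow3 p →
    (Important R l n p → digit i p = 1) ∧ (¬ Important R l n p → digit i p = 0)

/-- The colour of `n` is `c`. -/
def Color (n c : M.Num) : Prop :=
  ∃ p, p ≤ n ∧ ∃ i, i ≤ n ∧ Low n p ∧ Code R p n i ∧ c + 2 = 2 * digit n p + i % 2

section instances

variable [IsSet R] (b : Prop) (f g h : (ℕ → M.Num) → M.Num) [BFun f] [BFun g] [BFun h]

instance : Dfn b fun v => Enum R (f v) (g v) :=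
  have : Dfn b fun v : ℕ → M.Num => Enum R (v 1) (v 0) := by unfold Enum; infer_instance
  Dfn.subst₂ b (Enum R) f g

instance : Dfn b fun v => Important R (f v) (g v) (h v) :=
  have : Dfn b fun v : ℕ → M.Num => Important R (v 2) (v 1) (v 0) := by
    unfold Important; infer_instance
  Dfn.subst₃ b (Important R) f g h

instance : Dfn b fun v => Code R (f v) (g v) (h v) :=
  have : Dfn b fun v : ℕ → M.Num => Code R (v 2) (v 1) (v 0) := by unfold Code; infer_instance
  Dfn.subst₃ b (Code R) f g h

instance : Dfn b fun v => Color R (f v) (g v) :=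
  have : Dfn b fun v : ℕ → M.Num => Color R (v 1) (v 0) := by unfold Color; infer_instance
  Dfn.subst₂ b (Color R) f g

end instances

variable {R}

theorem Important.le {l n p : M.Num} (h : Important R l n p) : p ≤ n :=
  not_lt.1 fun hlt => h.2.1 (digit_eq_zero hlt)

theorem Code.digit_iff {l n i p : M.Num} (h : Code R l n i) (hp : Pow3 p) :
    (Important R l n p → digit i p = 1) ∧ (¬ Important R l n p → digit i p = 0) := by
  rcases le_or_gt p n with hle | hlt
  · exact h.2 p hle hp
  · exact ⟨fun hi => absurd hi.le (not_le.2 hlt), fun _ => digit_eq_zero (h.1.trans_lt hlt)⟩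

theorem Code.unique {l n i j : M.Num} (h : Code R l n i) (h' : Code R l n j) : i = j := by
  refine eq_of_digit_eq fun p hp => ?_
  by_cases hi : Important R l n p
  · rw [(h.digit_iff hp).1 hi, (h'.digit_iff hp).1 hi]
  · rw [(h.digit_iff hp).2 hi, (h'.digit_iff hp).2 hi]

theorem exists_code [IsSet R] (l n : M.Num) : ∃ i, Code R l n i := by
  -- The code is built for the truncations of `n`. The bound `i ≤ n % P` keeps the induction
  -- statement bounded and ensures that the new digit does not disturb the earlier ones.
  suffices key : ∀ P, Pow3 P → ∃ i, i ≤ n % P ∧ ∀ p, p < P → Pow3 p →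
      (Important R l n p → digit i p = 1) ∧ (¬ Important R l n p → digit i p = 0) by
    obtain ⟨P, hP, hlt⟩ := exists_pow3_gt n
    obtain ⟨i, hi, h⟩ := key P hP
    rw [mod_eq_self hlt] at hi
    exact ⟨i, hi, fun p hp => h p (hp.trans_lt hlt)⟩
  intro P hP
  refine pow3_induction (P := fun P => ∃ i, i ≤ n % P ∧ ∀ p, p < P → Pow3 p →
      (Important R l n p → digit i p = 1) ∧ (¬ Important R l n p → digit i p = 0)) ?_ ?_ hP
  · refine ⟨0, zero_le, fun p hp hp3 => (hp3.1 ?_).elim⟩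
    rwa [← zero_add (1 : M.Num), lt_add_one_iff, nonpos_iff_eq_zero] at hp
  rintro P hP ⟨i, hi, h⟩
  have hiP : i < P := hi.trans_lt (mod_lt n hP.1)
  have main (e : M.Num) (he : e ≤ digit n P)
      (hd : (Important R l n P → e = 1) ∧ (¬ Important R l n P → e = 0)) :
      ∃ i, i ≤ n % (P * 3) ∧ ∀ p, p < P * 3 → Pow3 p →
        (Important R l n p → digit i p = 1) ∧ (¬ Important R l n p → digit i p = 0) := by
    refine ⟨i + P * e, ?_, fun p hp hp3 => ?_⟩
    · rw [mod_mul_three n hP.1]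
      gcongr
    · rcases lt_trichotomy p P with hlt | rfl | hlt
      · obtain ⟨k, hk⟩ := hp3.mul_three_dvd hP hlt
        rw [hk, mul_assoc, digit_add_mul_three _ _ hp3.1]
        exact h p hlt hp3
      · have : digit (i + p * e) p = e := by
          rw [digit, div_add_mul _ _ hP.1, div_eq_zero hiP, zero_add]
          exact mod_eq_self (he.trans_lt (digit_lt _ _))
        rwa [this]
      · exact absurd (le_of_dvd hp3.1 (hP.mul_three_dvd hp3 hlt)) (not_le.2 hp)
  by_cases hI : Important R l n P
  · refine main 1 ?_ ⟨fun _ => rfl, fun h => (h hI).elim⟩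
    rw [← zero_add (1 : M.Num), add_one_le_iff]
    exact pos_iff_ne_zero.2 hI.2.1
  · exact main 0 zero_le ⟨fun h => (hI h).elim, fun _ => rfl⟩

/-- Below `q` nothing changes. At `q` the part below is `n`, and `hx` makes the place important.
Above `q` the part below is at least `q`, by which stage everything relevant has entered, so no
place there is important. -/
theorem Code.add {l n m q i : M.Num} (h : Code R l n i) (hn : n ≠ 0) (hq : Low m q) (hnq : n < q)
    (hx : ∃ x, x < l ∧ Enum R x q ∧ ¬ Enum R x n)
    (hs : ∀ x, x < l → ∀ y, M.pair x y ∈ R → Enum R x q) : Code R l (n + m) (i + q) := by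
  have hiq : i < q := h.1.trans_lt hnq
  obtain ⟨j, hj⟩ := hq.2.1
  have hj3 : ¬ j % 3 = 0 := by
    rw [← dvd_iff_mod_eq_zero three_ne_zero']
    rintro ⟨k, rfl⟩
    exact hq.2.2 ⟨k, by rw [hj, mul_assoc]⟩
  refine ⟨add_le_add h.1 hq.le, fun p _ hp => ?_⟩
  rcases lt_trichotomy p q with hlt | rfl | hlt
  · obtain ⟨k, hk⟩ := hp.mul_three_dvd hq.1 hlt
    have e1 : (n + m) % p = n % p := by
      rw [hj, hk, mul_assoc, mul_assoc, mod_add_mul _ _ hp.1]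
    have e2 : digit (n + m) p = digit n p := by
      rw [hj, hk, mul_assoc, digit_add_mul_three _ _ hp.1]
    have e3 : digit (i + q) p = digit i p := by
      rw [hk, digit_add_mul_three _ _ hp.1]
    have e4 : Important R l (n + m) p ↔ Important R l n p := by
      rw [Important, Important, e1, e2]
    rw [e3, e4]
    exact h.digit_iff hp
  · have e1 : (n + m) % p = n := by rw [hj, mod_add_mul _ _ hp.1, mod_eq_self hnq]
    have e2 : digit (n + m) p = j % 3 := by
      rw [digit, hj, div_add_mul _ _ hp.1, div_eq_zero hnq, zero_add]
    have e3 : digit (i + p) p = 1 := by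
      rw [digit]; nth_rw 1 [← mul_one p]
      rw [div_add_mul _ _ hp.1, div_eq_zero hiq, zero_add]
      exact mod_eq_self (by norm_num)
    have e4 : Important R l (n + m) p := by
      rw [Important, e1, e2]; exact ⟨hn, hj3, hx⟩
    exact ⟨fun _ => e3, fun h => (h e4).elim⟩
  · obtain ⟨k, hk⟩ := hq.1.mul_three_dvd hp hlt
    have e3 : digit (i + q) p = 0 := by
      refine digit_eq_zero (lt_of_lt_of_le ?_ (le_of_dvd hp.1 ⟨k, hk⟩))
      calc i + q < q + q := by gcongr
        _ = q * 2 := by ring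
        _ ≤ q * 3 := by gcongr; norm_num
    have e4 : ¬ Important R l (n + m) p := by
      rintro ⟨-, -, x, hxl, ⟨y, -, hy⟩, hE⟩
      -- If the remainder modulo `p` were below `q`, then, `p` being a multiple of `3 * q`,
      -- comparing quotients by `q` would give `3 ∣ j`, although `m = q * j` has lowest place `q`.
      refine hE ((hs x hxl y hy).mono (not_lt.1 fun hr => hj3 ?_))
      have := eq_div_mod (n + m) hp.1
      have h2 : q * j + n = q * (3 * k * ((n + m) / p)) + (n + m) % p := by
        rw [← hj, add_comm m n]
        nth_rw 1 [this, hk]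
        ring
      rw [div_mod_unique' hnq hr h2, ← dvd_iff_mod_eq_zero three_ne_zero', mul_assoc]
      exact dvd_mul_right _ _
    exact ⟨fun h => (e4 h).elim, fun _ => e3⟩

theorem color_iff {n c p i : M.Num} (hp : Low n p) (hi : Code R p n i) :
    Color R n c ↔ c + 2 = 2 * digit n p + i % 2 := by
  constructor
  · rintro ⟨q, -, j, -, hq, hj, h⟩
    obtain rfl := hp.unique hq
    obtain rfl := hi.unique hj
    exact h
  · exact fun h => ⟨p, hp.le, i, hi.1, hp, hi, h⟩

/-- The lowest digit is 1 or 2 and the parity 0 or 1, so `c = 2 * (digit - 1) + parity` takes the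
values 0 to 3; the `c + 2` in `Color` avoids the subtraction. -/
theorem exists_color [IsSet R] {n : M.Num} (hn : n ≠ 0) : ∃ c, c < 4 ∧ Color R n c := by
  obtain ⟨p, hp⟩ := exists_low hn
  obtain ⟨i, hi⟩ := exists_code (R := R) p n
  simp only [color_iff hp hi]
  have h2 : (2 : M.Num) ≠ 0 := by norm_num
  have hd := (low_iff_digit hp.1 hp.2.1).1 hp
  rcases (lt_three_iff.1 (digit_lt n p)).resolve_left hd with e | e <;>
    rcases lt_two_iff.1 (mod_lt i h2) with e' | e' <;> rw [e, e']
  exacts [⟨0, by norm_num, by norm_num⟩, ⟨1, by norm_num, by norm_num⟩,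
    ⟨2, by norm_num, by norm_num⟩, ⟨3, by norm_num, by norm_num⟩]

theorem Color.unique {n c d : M.Num} (h : Color R n c) (h' : Color R n d) : c = d := by
  obtain ⟨p, -, i, -, hp, hi, h⟩ := h
  rw [color_iff hp hi] at h'
  exact add_right_cancel (h.trans h'.symm)

/-- Equal colours have equal lowest digits and equal parities of the codes. -/
theorem digit_eq_of_color {n m c p q i j : M.Num} (h : Color R n c) (h' : Color R m c)
    (hp : Low n p) (hi : Code R p n i) (hq : Low m q) (hj : Code R q m j) :
    digit n p = digit m q ∧ i % 2 = j % 2 := by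
  rw [color_iff hp hi] at h
  rw [color_iff hq hj] at h'
  have h2 : (2 : M.Num) ≠ 0 := by norm_num
  have e := h.symm.trans h'
  have := div_mod_unique' (mod_lt i h2) (mod_lt j h2) e
  rw [this] at e
  exact ⟨this, add_left_cancel e⟩

theorem exists_coloring (R : Set M.Num) [IsSet R] :
    ∃ F ∈ M.sets, M.IsColoring F M.positive 4 ∧
      ∀ n c, M.pair n c ∈ F → Color R n c := by
  have h4 : M.numeral 4 = 4 := by rw [numeral_eq]; norm_num
  refine ⟨_, (bdd_comprehension (P := fun z => ∃ n, n ≤ z ∧ ∃ c, c ≤ z ∧ z = M.pair n c ∧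
    ¬ n = 0 ∧ Color R n c)).out, ⟨?_, ?_⟩, ?_⟩
  · rintro z ⟨n, -, c, -, rfl, hn, hc⟩
    obtain ⟨d, hd, hd'⟩ := exists_color (R := R) hn
    obtain rfl := hc.unique hd'
    exact ⟨n, c, pos_iff_ne_zero.2 hn, h4 ▸ hd, rfl⟩
  · intro n hn
    obtain ⟨c, -, hc⟩ := exists_color (R := R) (pos_iff_ne_zero.1 hn)
    refine ⟨c, ⟨n, left_le_pair _ _, c, right_le_pair _ _, rfl, pos_iff_ne_zero.1 hn, hc⟩, ?_⟩
    rintro d ⟨n', -, d', -, e, -, hd⟩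
    obtain ⟨rfl, rfl⟩ := pair_inj.1 e
    exact hd.unique hc
  · rintro n c ⟨n', -, c', -, e, -, hc⟩
    obtain ⟨rfl, rfl⟩ := pair_inj.1 e
    exact hc

/-! ### Sets whose sums have one colour -/

section homogeneous

variable [IsSet R] {H : Set M.Num} [IsSet H] {c : M.Num}

/-- In a set whose sums of at most two elements have the same colour, the largest powers of three
dividing the elements are unbounded. -/
theorem exists_low_gt (hpos : H ⊆ M.positive) (hinf : M.IsInfinite H)
    (hc : ∀ s ∈ M.sumsLe2 H, Color R s c) (b : M.Num) :
    ∃ m ∈ H, ∃ q, b < q ∧ Low m q := by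
  by_contra! hcon
  obtain ⟨S, hS, hSP⟩ := exists_pairs fun p h : M.Num => h ∈ H ∧ Low h p
  -- Every lowest place `≤ b` that occurs in `H` already occurs at an element below `s`, so an
  -- element above `s` must share its lowest place with a smaller one.
  obtain ⟨s, hs⟩ := strong_bounding S (b + 1)
  obtain ⟨m, hm, hsm⟩ := hinf s
  obtain ⟨p, hp⟩ := exists_low (pos_iff_ne_zero.1 (show 0 < m from hpos hm))
  have hpb : p < b + 1 := lt_add_one_iff.2 (not_lt.1 fun h => hcon m hm p h hp)
  obtain ⟨n, hns, hn⟩ := hs p hpb m ((hSP _ _).2 ⟨hm, hp⟩)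
  obtain ⟨hn, hnp⟩ := (hSP _ _).1 hn
  obtain ⟨i, hi⟩ := exists_code (R := R) p n
  obtain ⟨j, hj⟩ := exists_code (R := R) p m
  have e := (digit_eq_of_color (hc n (.inl hn)) (hc m (.inl hm)) hnp hi hp hj).1
  obtain ⟨h1, h2⟩ := hnp.digit_add_ne hp e
  obtain ⟨k, hk⟩ := exists_code (R := R) p (n + m)
  refine h2 (digit_eq_of_color (hc (n + m) (.inr ⟨n, hn, m, hm, ?_, rfl⟩)) (hc n (.inl hn))
    h1 hk hnp hi).1
  exact (hns.trans hsm).ne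

/-- Otherwise adding a suitable `m ∈ H` to `n` would create exactly one new important place and
change the parity. -/
theorem enum_of_mem (hpos : H ⊆ M.positive) (hinf : M.IsInfinite H)
    (hc : ∀ s ∈ M.sumsLe2 H, Color R s c) {n l x y : M.Num} (hn : n ∈ H) (hl : Low n l)
    (hx : x < l) (hy : M.pair x y ∈ R) : Enum R x n := by
  by_contra hE
  obtain ⟨s, hs⟩ := strong_bounding R l
  -- The bound `n + s` puts `q` above all digits of `n` and past the stage `s` by which every
  -- relevant `x < l` has entered.
  obtain ⟨m, hm, q, hq, hmq⟩ := exists_low_gt hpos hinf hc (n + s)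
  have hnq : n < q := le_self_add.trans_lt hq
  have hs' : ∀ x, x < l → ∀ y, M.pair x y ∈ R → Enum R x q := fun x hx y hy =>
    Enum.mono (hs x hx y hy) (le_add_self.trans hq.le)
  obtain ⟨i, hi⟩ := exists_code (R := R) l n
  have hi' := hi.add hl.ne_zero hmq hnq ⟨x, hx, hs' x hx y hy, hE⟩ hs'
  have hsum : n + m ∈ M.sumsLe2 H := .inr ⟨n, hn, m, hm, (hnq.trans_le hmq.le).ne, rfl⟩
  have := (digit_eq_of_color (hc _ (.inl hn)) (hc _ hsum) hl hi
    (hl.add_of_lt hmq (hl.le.trans_lt hnq)) hi').2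
  have h2 : (2 : M.Num) ≠ 0 := by norm_num
  have ho := hmq.1.odd
  have h1 := eq_div_mod q h2
  rw [ho] at h1
  have h3 := eq_div_mod i h2
  rcases lt_two_iff.1 (mod_lt i h2) with e | e
  · rw [e] at h3 this
    refine zero_ne_one (this.trans (div_mod_unique (q := i / 2 + q / 2) (by norm_num) ?_).2)
    nth_rw 1 [h3, h1]; ring
  · rw [e] at h3 this
    refine one_ne_zero (this.trans (div_mod_unique (q := i / 2 + q / 2 + 1) (by norm_num) ?_).2)
    nth_rw 1 [h3, h1]; ring

end homogeneous

end Coloring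

open Coloring in
/-- `HT^{≤2}_4` implies `Σ⁰₁` comprehension. -/
theorem sigma_comprehension_of_HTle2 (hHT : M.HTle2 4) (R : Set M.Num) [IsSet R] :
    IsSet {x : M.Num | ∃ y, M.pair x y ∈ R} := by
  obtain ⟨F, hF, hFc, hFR⟩ := exists_coloring R
  obtain ⟨H, hH, hpos, hinf, c, hc⟩ := hHT F hF hFc
  have : IsSet H := ⟨hH⟩
  replace hc : ∀ s ∈ M.sumsLe2 H, Color R s c := fun s hs => hFR _ _ (hc s hs)
  -- The `Π⁰₁` form asks that every `h ∈ H` with lowest place above `x` witness the entry of `x`;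
  -- such `h` exist because the lowest places are unbounded.
  refine delta_comprehension (P := fun x y => M.pair x y ∈ R)
    (Q := fun x h => h ∈ H → ∀ p, p ≤ h → Low h p → x < p → Enum R x h) fun x => ?_
  constructor
  · rintro ⟨y, hy⟩ h hh p _ hp hx
    exact enum_of_mem hpos hinf hc hh hp hx hy
  · intro h
    obtain ⟨m, hm, q, hq, hmq⟩ := exists_low_gt hpos hinf hc x
    obtain ⟨y, -, hy⟩ := h m hm q hmq.le hmq hq
    exact ⟨y, hy⟩

end SOA

namespace SOA

variable {M : L2Structure.{u}}

open Arith

/-! ### From `Σ⁰₁` comprehension to arithmetical comprehension -/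

/-- `M` is a model of `RCA₀` and of `Σ⁰₁` comprehension. -/
class SigmaCA (M : L2Structure.{u}) : Prop extends RCA M where
  sigma : ∀ (R : Set M.Num) [IsSet R], IsSet {x : M.Num | ∃ y, M.pair x y ∈ R}

theorem push_head_tail {α : Type u} (v : ℕ → α) : push (v 0) (fun i => v (i + 1)) = v := by
  funext i; cases i <;> rfl

theorem comp_push {α : Type u} (v : ℕ → α) (a : ℕ) (ρ : ℕ → ℕ) :
    v ∘ push a ρ = push (v a) (v ∘ ρ) := by
  funext i; cases i <;> rfl

theorem Dfn.inter {b : Prop} {P : (ℕ → M.Num) → Prop} (h : Dfn b P) (w : ℕ → M.Num) :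
    Dfn b fun v => P (inter v w) := by
  obtain ⟨V, w', φ, hb, h⟩ := h
  refine ⟨V, SOA.inter w w', φ.rename id (SOA.inter
    (SOA.inter (fun i => 2 * i) fun i => 2 * (2 * i) + 1) fun i => 2 * (2 * i + 1) + 1),
    fun hh => (hb hh).rename _ _, fun v => ?_⟩
  refine Iff.trans ?_ (h (SOA.inter v w))
  rw [Formula.sat_rename, inter_comp_inter, inter_comp_inter]
  have e1 : (SOA.inter v (SOA.inter w w') ∘ fun i => 2 * i) = v := by funext i; simp
  have e2 : (SOA.inter v (SOA.inter w w') ∘ fun i => 2 * (2 * i) + 1) = w := by funext i; simp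
  have e3 : (SOA.inter v (SOA.inter w w') ∘ fun i => 2 * (2 * i + 1) + 1) = w' := by
    funext i; simp
  rw [e1, e2, e3]
  rfl

theorem Term.tm_val (t : Term) : Tm fun v : ℕ → M.Num => t.val M v := by
  induction t with
  | var i => exact Tm.var i
  | zero => exact Tm.const 0
  | one => exact Tm.const 1
  | add s t hs ht => exact Tm.add _ _
  | mul s t hs ht => exact Tm.mul _ _

theorem Term.exists_support (t : Term) : ∃ k, ∀ v v' : ℕ → M.Num, (∀ i, i < k → v i = v' i) →
    t.val M v = t.val M v' := by
  induction t with
  | var i => exact ⟨i + 1, fun v v' h => h i (Nat.lt_succ_self i)⟩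
  | zero => exact ⟨0, fun _ _ _ => rfl⟩
  | one => exact ⟨0, fun _ _ _ => rfl⟩
  | add s t hs ht | mul s t hs ht =>
    obtain ⟨k, hk⟩ := hs
    obtain ⟨l, hl⟩ := ht
    refine ⟨max k l, fun v v' h => ?_⟩
    rw [Term.val, Term.val, hk v v' fun i hi => h i (hi.trans_le (le_max_left _ _)),
      hl v v' fun i hi => h i (hi.trans_le (le_max_right _ _))]

theorem push_congr {α : Type u} {v v' : ℕ → α} {k : ℕ} (h : ∀ i, i < k → v i = v' i) (a : α) :
    ∀ i, i < k + 1 → push a v i = push a v' i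
  | 0, _ => rfl
  | i + 1, hi => h i (Nat.lt_of_succ_lt_succ hi)

/-- Finite support permits the induction on the number of free variables in `Dfn.ex_of_support`. -/
theorem Formula.exists_support (V : ℕ → M.sets) (φ : Formula) :
    ∃ k, ∀ v v' : ℕ → M.Num, (∀ i, i < k → v i = v' i) → (φ.Sat M V v ↔ φ.Sat M V v') := by
  induction φ with
  | eq s t | lt s t =>
    obtain ⟨k, hk⟩ := s.exists_support (M := M)
    obtain ⟨l, hl⟩ := t.exists_support (M := M)
    refine ⟨max k l, fun v v' h => ?_⟩
    rw [Formula.Sat, Formula.Sat, hk v v' fun i hi => h i (hi.trans_le (le_max_left _ _)),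
      hl v v' fun i hi => h i (hi.trans_le (le_max_right _ _))]
  | mem t X =>
    obtain ⟨l, hl⟩ := t.exists_support (M := M)
    exact ⟨l, fun v v' h => by rw [Formula.Sat, Formula.Sat, hl v v' h]⟩
  | neg φ hφ =>
    obtain ⟨l, hl⟩ := hφ
    exact ⟨l, fun v v' h => by rw [Formula.Sat, Formula.Sat, hl v v' h]⟩
  | and φ ψ hφ hψ | or φ ψ hφ hψ | imp φ ψ hφ hψ | iff φ ψ hφ hψ =>
    obtain ⟨k, hk⟩ := hφ
    obtain ⟨l, hl⟩ := hψ
    refine ⟨max k l, fun v v' h => ?_⟩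
    rw [Formula.Sat, Formula.Sat, hk v v' fun i hi => h i (hi.trans_le (le_max_left _ _)),
      hl v v' fun i hi => h i (hi.trans_le (le_max_right _ _))]
  | ballLt t φ hφ | bexLt t φ hφ =>
    obtain ⟨k, hk⟩ := t.exists_support (M := M)
    obtain ⟨l, hl⟩ := hφ
    refine ⟨max k l, fun v v' h => ?_⟩
    simp only [Formula.Sat]
    rw [hk v v' fun i hi => h i (hi.trans_le (le_max_left _ _))]
    have (a : M.Num) := hl _ _ fun i hi => push_congr
      (fun i hi => h i (hi.trans_le (le_max_right k l))) a i (Nat.lt_succ_of_lt hi)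
    simp only [this]
  | all φ hφ | ex φ hφ =>
    obtain ⟨l, hl⟩ := hφ
    refine ⟨l, fun v v' h => ?_⟩
    have (a : M.Num) := hl _ _ fun i hi => push_congr h a i (Nat.lt_succ_of_lt hi)
    simp only [Formula.Sat, this]

theorem Dfn.exists_support {b : Prop} {P : (ℕ → M.Num) → Prop} (hP : Dfn b P) :
    ∃ k, ∀ v v' : ℕ → M.Num, (∀ i, i < k → v i = v' i) → (P v ↔ P v') := by
  obtain ⟨V, w, φ, -, h⟩ := hP
  obtain ⟨k, hk⟩ := φ.exists_support V
  refine ⟨k, fun v v' hv => ?_⟩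
  rw [← h, ← h]
  refine hk _ _ fun i hi => ?_
  unfold SOA.inter
  rw [hv (i / 2) ((Nat.div_le_self i 2).trans_lt hi)]

section SigmaCA

variable [hM : SigmaCA M]

/-- Here `k` counts the free variables besides the quantified one. With none the result is a
constant truth value; with one, `Σ⁰₁` comprehension turns it into membership in a set; with more,
the first two are packed into a pair. -/
theorem Dfn.ex_of_support (k : ℕ) (P : (ℕ → M.Num) → Prop) [hP : Dfn True P]
    (hk : ∀ v v' : ℕ → M.Num, (∀ i, i < k + 1 → v i = v' i) → P v → P v') :
    Dfn True fun v => ∃ a, P (push a v) := by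
  induction k generalizing P with
  | zero =>
    refine Dfn.congr (P := fun _ => ∃ a, P (push a fun _ => 0)) inferInstance fun v => ?_
    refine exists_congr fun a => ⟨hk _ _ fun i hi => ?_, hk _ _ fun i hi => ?_⟩ <;>
    · obtain rfl : i = 0 := by omega
      rfl
  | succ k ih =>
    cases k with
    | zero =>
      have : Dfn True fun v : ℕ → M.Num => P (push (v 0) fun _ => v 1) :=
        (Dfn.comp True (push 0 fun _ => 1)).congr fun v => by rw [comp_push]; rfl
      obtain ⟨R, hR, hRP⟩ := exists_pairs fun x a : M.Num => P (push a fun _ => x)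
      have := hM.sigma R
      refine Dfn.congr (P := fun v => v 0 ∈ {x : M.Num | ∃ y, M.pair x y ∈ R}) inferInstance
        fun v => exists_congr fun a => ?_
      rw [hRP]
      refine ⟨hk _ _ fun i hi => ?_, hk _ _ fun i hi => ?_⟩ <;>
      · obtain rfl | rfl : i = 0 ∨ i = 1 := by omega
        all_goals rfl
    | succ k =>
      have h1 : Dfn True fun v : ℕ → M.Num =>
          P (push (v 2) (push (v 1) (push (v 0) fun i => v (i + 1 + 1 + 2)))) :=
        (Dfn.comp True (P := P) (push 2 (push 1 (push 0 fun i => i + 1 + 1 + 2)))).congr fun v => by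
          rw [comp_push, comp_push, comp_push]; rfl
      -- Variable `1` now holds the code of the pair, which lowers the support by one.
      have h2 := ih (fun v => ∃ x, x ≤ v 1 ∧ ∃ y, y ≤ v 1 ∧ v 1 = M.pair x y ∧
        P (push (v 0) (push x (push y fun i => v (i + 2))))) <| by
          rintro v v' h ⟨x, hx, y, hy, e, hP⟩
          rw [h 1 (by omega)] at hx hy e
          refine ⟨x, hx, y, hy, e, hk _ _ (fun i hi => ?_) hP⟩
          match i, hi with
          | 0, _ => exact h 0 (by omega)
          | 1, _ => rfl
          | 2, _ => rfl
          | i + 3, hi => exact h (i + 2) (by omega)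
      have h3 : Dfn True fun v : ℕ → M.Num => ∃ a, ∃ x, x ≤ v 0 ∧ ∃ y, y ≤ v 0 ∧
          v 0 = M.pair x y ∧ P (push a (push x (push y fun i => v (i + 1 + 2)))) :=
        (Dfn.comp True (P := fun v => ∃ a, ∃ x, x ≤ v 0 ∧ ∃ y, y ≤ v 0 ∧
          v 0 = M.pair x y ∧ P (push a (push x (push y fun i => v (i + 1))))) (h := h2)
          (push 0 fun i => i + 3)).congr fun v => by rw [comp_push]; rfl
      refine (Dfn.subst True (fun v => M.pair (v 0) (v 1)) fun z v => ∃ a, ∃ x, x ≤ z ∧ ∃ y,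
        y ≤ z ∧ z = M.pair x y ∧ P (push a (push x (push y fun i => v (i + 2))))).congr fun v => ?_
      refine exists_congr fun a => ⟨?_, fun h => ?_⟩
      · rintro ⟨x, -, y, -, e, h⟩
        obtain ⟨rfl, rfl⟩ := pair_inj.1 e
        rwa [push_head_tail (fun i => v (i + 1)), push_head_tail] at h
      · refine ⟨_, left_le_pair _ _, _, right_le_pair _ _, rfl, ?_⟩
        rwa [push_head_tail (fun i => v (i + 1)), push_head_tail]

theorem Dfn.ex_bounded (P : (ℕ → M.Num) → Prop) [hP : Dfn True P] :
    Dfn True fun v => ∃ a, P (push a v) := by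
  obtain ⟨k, hk⟩ := hP.exists_support
  exact Dfn.ex_of_support k P fun v v' h =>
    (hk v v' fun i hi => h i (Nat.lt_succ_of_lt hi)).1

/-- With `Σ⁰₁` comprehension, all arithmetical formulas are equivalent to bounded formulas with
parameters. -/
theorem Formula.dfn_sat (V : ℕ → M.sets) (φ : Formula) : Dfn True fun v => φ.Sat M V v := by
  induction φ with
  | eq s t | lt s t =>
    have := s.tm_val (M := M)
    have := t.tm_val (M := M)
    simp only [Formula.Sat]; infer_instance
  | mem t X =>
    have := t.tm_val (M := M)
    have : IsSet (V X : Set M.Num) := ⟨(V X).2⟩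
    simp only [Formula.Sat]; infer_instance
  | neg φ hφ => simp only [Formula.Sat]; infer_instance
  | and φ ψ hφ hψ | or φ ψ hφ hψ | imp φ ψ hφ hψ | iff φ ψ hφ hψ =>
    simp only [Formula.Sat]; infer_instance
  | ballLt t φ hφ | bexLt t φ hφ =>
    have := t.tm_val (M := M)
    have : Dfn True fun v => φ.Sat M V (push (v 0) fun i => v (i + 1)) :=
      hφ.congr fun v => by rw [push_head_tail]
    simp only [Formula.Sat]
    first
      | exact Dfn.ballLt True (fun v => t.val M v) fun a v => φ.Sat M V (push a v)
      | exact Dfn.bexLt True (fun v => t.val M v) fun a v => φ.Sat M V (push a v)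
  | all φ hφ =>
    have := Dfn.ex_bounded (fun v => ¬ φ.Sat M V v)
    refine (Dfn.not True (fun v => ∃ a, ¬ φ.Sat M V (push a v))).congr fun v => ?_
    simp only [Formula.Sat, not_exists, not_not]
  | ex φ hφ => exact Dfn.ex_bounded fun v => φ.Sat M V v

theorem Dfn.to_bounded {b : Prop} (P : (ℕ → M.Num) → Prop) [h : Dfn b P] : Dfn True P := by
  obtain ⟨V, w, φ, -, h⟩ := h
  exact ((φ.dfn_sat V).inter w).congr h

theorem dfn_comprehension {P : M.Num → Prop} [h : Dfn False fun v => P (v 0)] :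
    IsSet {n | P n} :=
  have := Dfn.to_bounded (h := h)
  bdd_comprehension

theorem dfn_induction {P : M.Num → Prop} [h : Dfn False fun v => P (v 0)]
    (h0 : P 0) (hs : ∀ n, P n → P (n + 1)) (n : M.Num) : P n :=
  have := Dfn.to_bounded (h := h)
  bdd_induction h0 hs n

theorem dfn_strong_induction {P : M.Num → Prop} [h : Dfn False fun v => P (v 0)]
    (hs : ∀ n, (∀ m, m < n → P m) → P n) (n : M.Num) : P n :=
  have := Dfn.to_bounded (h := h)
  bdd_strong_induction hs n

variable (M) in
theorem modelsACA0 : M.ModelsACA0 where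
  basic := hM.out.basic
  induction X hX h0 hs n :=
    have : IsSet X := ⟨hX⟩
    bdd_induction (P := fun n => n ∈ X) h0 hs n
  comprehension φ V v := by
    have : Dfn True fun v' : ℕ → M.Num => φ.Sat M V (push (v' 0) v) :=
      (Dfn.inter (Dfn.comp True (h := φ.dfn_sat V) (push 0 fun i => 2 * i + 1)) v).congr
        fun v' => by rw [comp_push, inter_comp_right]; rfl
    exact ⟨_, (bdd_comprehension (P := fun n => φ.Sat M V (push n v))).out, fun n => Iff.rfl⟩

end SigmaCA

/-! ### Course-of-values recursion in models of arithmetical comprehension -/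

/-- The set coded by `u` and `L`. -/
def dec [RCA M] (u L : M.Num) : Set M.Num := {i | modulus L i ∣ u}

instance [RCA M] (b : Prop) (f g h : (ℕ → M.Num) → M.Num) [BFun f] [BFun g] [BFun h] :
    Dfn b fun v => f v ∈ dec (g v) (h v) :=
  inferInstanceAs (Dfn b fun v => modulus (h v) (f v) ∣ g v)

variable [hM : SigmaCA M]

/-- The code is the product of the moduli of the elements of `X` below `b`, built one factor at a
time; coprimality keeps the other memberships unchanged. -/
theorem exists_dec (X : Set M.Num) [IsSet X] (b : M.Num) :
    ∃ u L, ∀ i, i < b → (i ∈ dec u L ↔ i ∈ X) := by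
  obtain ⟨L, hL0, hL⟩ := exists_multiple b
  suffices key : ∀ c, c ≤ b → ∃ u, ∀ i, i < b → (i ∈ dec u L ↔ i ∈ X ∧ i < c) by
    obtain ⟨u, hu⟩ := key b le_rfl
    exact ⟨u, L, fun i hi => by rw [hu i hi, and_iff_left hi]⟩
  refine dfn_induction (P := fun c => c ≤ b → ∃ u, ∀ i, i < b → (i ∈ dec u L ↔ i ∈ X ∧ i < c))
    (fun _ => ⟨1, fun i _ => ?_⟩) fun c ih hc => ?_
  · refine ⟨fun h => ?_, fun h => (not_lt_zero h.2).elim⟩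
    exact absurd (le_of_dvd one_ne_zero h) (not_le.2 (one_lt_modulus hL0 i))
  · have hcb : c < b := add_one_le_iff.1 hc
    obtain ⟨u, hu⟩ := ih hcb.le
    by_cases hX : c ∈ X
    · refine ⟨modulus L c * u, fun i hi => ?_⟩
      rcases eq_or_ne i c with rfl | hic
      · exact ⟨fun _ => ⟨hX, lt_add_one_iff.2 le_rfl⟩, fun _ => dvd_mul_right _ _⟩
      · rw [lt_add_one_iff, le_iff_lt_or_eq, or_iff_left hic, ← hu i hi]
        exact ⟨dvd_of_modulus_dvd_mul hL hcb hi hic.symm, fun h => Dvd.dvd.mul_left h _⟩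
    · refine ⟨u, fun i hi => ?_⟩
      rw [hu i hi, lt_add_one_iff, le_iff_lt_or_eq]
      refine and_congr_right fun hi => ⟨.inl, fun h => h.resolve_right ?_⟩
      rintro rfl
      exact hX hi

/-- A set can be defined by deciding membership of `n` from its part below `n`. -/
theorem exists_recursive_set (Φ : M.Num → Set M.Num → Prop)
    (hΦ : ∀ n X Y, (∀ i, i < n → (i ∈ X ↔ i ∈ Y)) → Φ n X → Φ n Y)
    [hd : Dfn False fun v => Φ (v 2) (dec (v 1) (v 0))] :
    ∃ H : Set M.Num, IsSet H ∧ ∀ n, n ∈ H ↔ Φ n H := by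
  have inst : ∀ (f g h : (ℕ → M.Num) → M.Num) [BFun f] [BFun g] [BFun h],
      Dfn False fun v => Φ (f v) (dec (g v) (h v)) := fun f g h =>
    have : Dfn False fun v : ℕ → M.Num => Φ (v 2) (dec (v 1) (v 0)) := hd
    Dfn.subst₃ False (fun a b c => Φ a (dec b c)) f g h
  have hΦ' {n X Y} (h : ∀ i, i < n → (i ∈ X ↔ i ∈ Y)) : Φ n X ↔ Φ n Y :=
    ⟨hΦ n X Y h, hΦ n Y X fun i hi => (h i hi).symm⟩
  -- Coded approximations that obey the recursion below `x`. They exist for every `x` and agree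
  -- wherever both are correct, so together they define the set.
  let App (x u L : M.Num) : Prop := ∀ n, n < x → (n ∈ dec u L ↔ Φ n (dec u L))
  have agree {x y u L u' L'} (h : App x u L) (h' : App y u' L') (n : M.Num) :
      n < x → n < y → (n ∈ dec u L ↔ n ∈ dec u' L') := by
    refine dfn_strong_induction
      (P := fun n => n < x → n < y → (n ∈ dec u L ↔ n ∈ dec u' L')) (fun n ih hx hy => ?_) n
    rw [h n hx, h' n hy]
    exact hΦ' fun i hi => ih i hi (hi.trans hx) (hi.trans hy)
  have exist (x : M.Num) : ∃ u L, App x u L := by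
    refine dfn_induction
      (P := fun x => ∃ u L : M.Num, ∀ n, n < x → (n ∈ dec u L ↔ Φ n (dec u L)))
      ⟨0, 0, fun n hn => (not_lt_zero hn).elim⟩ (fun x ⟨u, L, h⟩ => ?_) x
    have : IsSet {n | (n < x ∧ n ∈ dec u L) ∨ (n = x ∧ Φ x (dec u L))} := dfn_comprehension
    obtain ⟨u', L', h'⟩ := exists_dec {n | (n < x ∧ n ∈ dec u L) ∨ (n = x ∧ Φ x (dec u L))} (x + 1)
    have hlt (n : M.Num) (hn : n < x) : n ∈ dec u' L' ↔ n ∈ dec u L := by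
      rw [h' n (hn.trans (lt_add_one_iff.2 le_rfl))]
      exact ⟨fun h => h.elim And.right fun h => absurd h.1 hn.ne, fun h => .inl ⟨hn, h⟩⟩
    refine ⟨u', L', fun n hn => ?_⟩
    rcases (lt_add_one_iff.1 hn).lt_or_eq with hn' | rfl
    · rw [hlt n hn', h n hn']
      exact hΦ' fun i hi => (hlt i (hi.trans hn')).symm
    · rw [h' n hn]
      refine Iff.trans ⟨fun h => h.elim (fun h => absurd h.1 (lt_irrefl _)) And.right,
        fun h => .inr ⟨rfl, h⟩⟩ (hΦ' fun i hi => (hlt i hi).symm)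
  have hH : IsSet {n | ∃ u L : M.Num, (∀ k, k < n + 1 → (k ∈ dec u L ↔ Φ k (dec u L))) ∧
    n ∈ dec u L} := dfn_comprehension
  refine ⟨_, hH, fun n => ?_⟩
  obtain ⟨u, L, h⟩ := exist (n + 1)
  have hs (k : M.Num) : k < k + 1 := lt_add_one_iff.2 le_rfl
  have main (k : M.Num) (hk : k < n + 1) :
      (k ∈ {n | ∃ u L : M.Num, (∀ k, k < n + 1 → (k ∈ dec u L ↔ Φ k (dec u L))) ∧
        n ∈ dec u L}) ↔ k ∈ dec u L := by
    constructor
    · rintro ⟨u', L', h', hk'⟩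
      exact (agree h' h k (hs k) hk).1 hk'
    · exact fun hk' => ⟨u, L, fun i hi => h i (hi.trans_le (add_one_le_iff.2 hk)), hk'⟩
  rw [main n (hs n), h n (hs n)]
  exact hΦ' fun i hi => (main i (hi.trans (hs n))).symm

/-! ### Ramsey's theorem for triples -/

/-- For a definable family of sets `R i` and an infinite set `P` there is an infinite `Q ⊆ P` all
of whose elements behave in the same way with respect to the `R i`, for `i` bounded in terms of
smaller elements of `Q`. -/
theorem exists_cohesive (R : M.Num → M.Num → Prop) [hR : Dfn False fun v => R (v 1) (v 0)]
    (P : Set M.Num) [IsSet P] (hP : M.IsInfinite P) :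
    ∃ E Q : Set M.Num, IsSet E ∧ IsSet Q ∧ Q ⊆ P ∧ M.IsInfinite Q ∧
      ∀ q ∈ Q, ∀ n ∈ Q, q < n → ∀ i, i ≤ M.pair q q → (R i n ↔ i ∈ E) := by
  have inst : ∀ (f g : (ℕ → M.Num) → M.Num) [BFun f] [BFun g], Dfn False fun v => R (f v) (g v) :=
    fun f g =>
    have : Dfn False fun v : ℕ → M.Num => R (v 1) (v 0) := hR
    Dfn.subst₂ False R f g
  -- Greedy choice: `a` is left out of `E` exactly when infinitely many `n ∈ P` fail `R a` and agree
  -- with the choices below `a`. Thus infinitely many `n ∈ P` agree with every initial part of `E`.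
  obtain ⟨E, hE, hEΦ⟩ := exists_recursive_set (M := M)
    (fun a X => ¬ ∀ k, ∃ n, k < n ∧ n ∈ P ∧ ¬ R a n ∧ ∀ b, b < a → (R b n ↔ b ∈ X))
    fun a X Y h h' hc => h' fun k => by
      obtain ⟨n, hk, hn, hr, hX⟩ := hc k
      exact ⟨n, hk, hn, hr, fun b hb => (hX b hb).trans (h b hb).symm⟩
  have res (x : M.Num) : ∀ k, ∃ n, k < n ∧ n ∈ P ∧ ∀ b, b < x → (R b n ↔ b ∈ E) := by
    refine dfn_induction
      (P := fun x => ∀ k, ∃ n, k < n ∧ n ∈ P ∧ ∀ b, b < x → (R b n ↔ b ∈ E)) ?_ ?_ x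
    · intro k
      obtain ⟨n, hn, hk⟩ := hP k
      exact ⟨n, hk, hn, fun b hb => (not_lt_zero hb).elim⟩
    · intro x ih k
      by_cases hx : x ∈ E
      · have h := (hEΦ x).1 hx
        push Not at h
        -- Beyond `t`, every `n ∈ P` that agrees with `E` below `x` satisfies `R x n`.
        obtain ⟨t, ht⟩ := h
        obtain ⟨n, hn, hnP, hb⟩ := ih (k + t)
        refine ⟨n, le_self_add.trans_lt hn, hnP, fun b hbx => ?_⟩
        rcases (lt_add_one_iff.1 hbx).lt_or_eq with h | rfl
        · exact hb b h
        · refine iff_of_true ?_ hx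
          by_contra hr
          obtain ⟨c, hc, hc'⟩ := ht n (le_add_self.trans_lt hn) hnP hr
          have := hb c hc
          tauto
      · have h := not_not.1 (mt (hEΦ x).2 hx)
        obtain ⟨n, hn, hnP, hr, hb⟩ := h k
        refine ⟨n, hn, hnP, fun b hbx => ?_⟩
        rcases (lt_add_one_iff.1 hbx).lt_or_eq with h | rfl
        · exact hb b h
        · exact iff_of_false hr hx
  obtain ⟨Q, hQ, hQΦ⟩ := exists_recursive_set (M := M)
    (fun n X => n ∈ P ∧ ∀ q, q < n → q ∈ X → ∀ i, i ≤ M.pair q q → (R i n ↔ i ∈ E))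
    fun n X Y h h' => ⟨h'.1, fun q hq hqY => h'.2 q hq ((h q hq).2 hqY)⟩
  refine ⟨E, Q, hE, hQ, fun n hn => ((hQΦ n).1 hn).1, fun x => ?_,
    fun q hq n hn hqn => ((hQΦ n).1 hn).2 q hqn hq⟩
  -- If `Q` has no element between `x` and `n`, all earlier `q ∈ Q` are `≤ x`, and `M.pair x x`
  -- bounds all indices they impose.
  obtain ⟨n, hxn, hnP, hn⟩ := res (M.pair x x + 1) x
  by_cases h : ∃ q ∈ Q, x < q ∧ q < n
  · obtain ⟨q, hq, hxq, -⟩ := h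
    exact ⟨q, hq, hxq⟩
  · push Not at h
    refine ⟨n, (hQΦ n).2 ⟨hnP, fun q hqn hq i hi => hn i ?_⟩, hxn⟩
    have : q ≤ x := not_lt.1 fun hxq => not_lt.2 (h q hq hxq) hqn
    exact lt_add_one_iff.2 (hi.trans (pair_mono this this))

theorem infinite_inter_or_diff {P E : Set M.Num} (hP : M.IsInfinite P) :
    M.IsInfinite (P ∩ E) ∨ M.IsInfinite (P \ E) := by
  by_contra! h
  obtain ⟨h1, h2⟩ := h
  simp only [L2Structure.IsInfinite] at h1 h2
  push Not at h1 h2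
  obtain ⟨a, ha⟩ := h1
  obtain ⟨b, hb⟩ := h2
  obtain ⟨n, hn, hlt⟩ := hP (a + b)
  by_cases hE : n ∈ E
  · exact not_lt.2 (ha n ⟨hn, hE⟩) (le_self_add.trans_lt hlt)
  · exact not_lt.2 (hb n ⟨hn, hE⟩) (le_add_self.trans_lt hlt)

variable (M) in
theorem ramsey_triples : M.RT3 2 := by
  intro F hF hFc
  have hF' : IsSet F := ⟨hF⟩
  have h2 : M.numeral 2 = 2 := by rw [numeral_eq]; norm_num
  have hpos : IsSet {x : M.Num | 0 < x} := bdd_comprehension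
  have tr : ∀ f g : (ℕ → M.Num) → M.Num, ∀ [BFun f] [BFun g],
      Dfn False fun v => ∃ a b, f v = M.pair a b ∧ M.pair (M.triple a b (g v)) 1 ∈ F := fun f g =>
    have : Dfn False fun v : ℕ → M.Num =>
        ∃ a b, v 1 = M.pair a b ∧ M.pair (M.triple a b (v 0)) 1 ∈ F := by
      unfold L2Structure.triple; infer_instance
    Dfn.subst₂ False (fun i n => ∃ a b, i = M.pair a b ∧ M.pair (M.triple a b n) 1 ∈ F) f g
  -- Indices are codes of pairs: on `Q` the colour of `(a, b, n)` no longer depends on `n`. The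
  -- bound `M.pair q q` covers all pairs from elements up to `q`. The second application does the
  -- same for the induced colouring of pairs.
  obtain ⟨E, Q, hE, hQ, hQP, hQi, hQE⟩ := exists_cohesive
    (fun i n : M.Num => ∃ a b, i = M.pair a b ∧ M.pair (M.triple a b n) 1 ∈ F)
    {x : M.Num | 0 < x} fun n => ⟨n + 1, show 0 < n + 1 from
      zero_le.trans_lt (lt_add_one_iff.2 le_rfl), lt_add_one_iff.2 le_rfl⟩
  obtain ⟨E', Q', hE', hQ', hQ'Q, hQ'i, hQE'⟩ := exists_cohesive
    (fun a n : M.Num => M.pair a n ∈ E) Q hQi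
  have key : ∀ x ∈ Q', ∀ y ∈ Q', ∀ z ∈ Q', x < y → y < z →
      (M.pair (M.triple x y z) 1 ∈ F ↔ x ∈ E') := by
    intro x hx y hy z hz hxy hyz
    rw [← hQE' x hx y hy hxy x (left_le_pair x x),
      ← hQE y (hQ'Q hy) z (hQ'Q hz) hyz _ (pair_mono hxy.le le_rfl)]
    refine ⟨fun h => ⟨x, y, rfl, h⟩, ?_⟩
    rintro ⟨a, b, e, h⟩
    obtain ⟨rfl, rfl⟩ := pair_inj.1 e
    exact h
  have color (x y z : M.Num) (hx : 0 < x) (hxy : x < y) (hyz : y < z)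
      (h : M.pair (M.triple x y z) 1 ∉ F) : M.pair (M.triple x y z) 0 ∈ F := by
    obtain ⟨c, hc, -⟩ := hFc.2 (M.triple x y z) ⟨x, y, z, hx, hxy, hyz, rfl⟩
    obtain ⟨x', c', -, hc', e⟩ := hFc.1 _ hc
    obtain ⟨-, rfl⟩ := pair_inj.1 e
    rw [h2] at hc'
    rcases lt_two_iff.1 hc' with rfl | rfl
    exacts [hc, (h hc).elim]
  have sub : Q' ⊆ M.positive := fun x hx => hQP (hQ'Q hx)
  rcases infinite_inter_or_diff (E := E') hQ'i with h | h
  · have : IsSet {x | x ∈ Q' ∧ x ∈ E'} := bdd_comprehension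
    exact ⟨_, this.out, fun x hx => sub hx.1, h, 1, fun x hx y hy z hz hxy hyz =>
      (key x hx.1 y hy.1 z hz.1 hxy hyz).2 hx.2⟩
  · have : IsSet {x | x ∈ Q' ∧ ¬ x ∈ E'} := bdd_comprehension
    exact ⟨_, this.out, fun x hx => sub hx.1, h, 0, fun x hx y hy z hz hxy hyz =>
      color x y z (sub hx.1) hxy hyz fun h => hx.2 ((key x hx.1 y hy.1 z hz.1 hxy hyz).1 h)⟩

end SOA

/-- `RCA₀ + HT^{≤2}_4` implies `ACA₀` and `RT^3_2`: every model of `RCA₀` that satisfies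
`HT^{≤2}_4` is a model of `ACA₀` and satisfies `RT^3_2`. -/
theorem mainTheorem1 (M : SOA.L2Structure.{u}) (hRCA : M.ModelsRCA0) (hHT : M.HTle2 4) :
    M.ModelsACA0 ∧ M.RT3 2 :=
  have : SOA.RCA M := ⟨hRCA⟩
  have : SOA.SigmaCA M := { sigma := fun R => SOA.sigma_comprehension_of_HTle2 hHT R }
  ⟨SOA.modelsACA0 M, SOA.ramsey_triples M⟩
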